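/- Let $(N,\phi,\xi,\eta,g)$ be a $(2n+1)$-dimensional $C^\infty$ almost contact metric manifold, i.e. $\phi$ is a $(1,1)$-tensor field, $\xi$ a vector field, $\eta$ a $1$-form and $g$ a Riemannian metric with $$\phi^2=-I+\eta\otimes\xi,\qquad \eta(\xi)=1,\qquad g(\phi X,\phi Y)=g(X,Y)-\eta(X)\eta(Y).$$ Let $\overline\nabla$ be the Levi-Civita connection of $g$, put $\Phi(X,Y)=g(X,\phi Y)$ and $2\,d\eta(X,Y)=X\eta(Y)-Y\eta(X)-\eta([X,Y])$. Call the structure *normal* if $$\phi^2[X,Y]+[\phi X,\phi Y]-\phi[\phi X,Y]-\phi[X,\phi Y]+2\,d\eta(X,Y)\,\xi=0 .$$ Assume that $N$ is one of the following: *cosymplectic* ($d\eta=0$, $d\Phi=0$, and normal), *Sasakian* ($\Phi=d\eta$, and normal), or *Kenmotsu* ($(\overline\nabla_X\phi)Y=g(\phi X,Y)\xi-\eta(Y)\phi X$). Let $\iota:M\to N$ be an immersed submanifold with the induced metric; we identify $X\in T_pM$ with $d\iota(X)$. For $p\in M$ put $M_p=\{X\in T_pM : g(X,\xi)=0\}$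 and $T^1M=\bigcup_{p\in M} M_p$. For $X\in T_pM$ write $\phi X=TX+FX$ with $TX$ tangent and $FX$ normal to $M$. Assume that $M$ is a *slant submanifold* with slant angle $\theta$: for every $p\in M$ and every nonzero $X\in M_p$, the angle between $\phi X$ and the space $M_p$ equals the constant $\theta$. Assume moreover that $TX\in M_p$ whenever $X\in M_p$, i.e. that the angle between $\phi X$ and $M_p$ is also the angle between $\phi X$ and $T_pM$ (this holds automatically if at each point of $M$ the vector $\xi$ is tangent or normal to $M$). Then $$A_{FX}\,TX=A_{FTX}\,X\qquad\text{for all } X\in T^1M ,$$ where, for $Z$ normal and $X$ tangent to $M$, $A_ZX$ is the shape operator: minus the tangential part of $\overline\nabla_X Z$. -/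

import Mathlib

open Bundle Manifold
open scoped ContDiff

noncomputable section

namespace SlantGeometry

section Ambient

variable {E : Type*} [NormedAddCommGroup E] [NormedSpace ℝ E]
  {H : Type*} [TopologicalSpace H] {I : ModelWithCorners ℝ E H}
  {N : Type*} [TopologicalSpace N] [ChartedSpace H N]

/-- (Not necessarily continuous) vector fields on `N`. -/
abbrev VField (I : ModelWithCorners ℝ E H) (N : Type*) [TopologicalSpace N] [ChartedSpace H N] :
    Type _ :=
  (x : N) → TangentSpace I x

/-- The value at `p` of the exterior derivative of a `1`-form, in the normalisation
`2 dα(X, Y) = X(α Y) - Y(α X) - α [X, Y]` that is customary in contact metric geometry. -/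
def extDerivOne (α : (x : N) → TangentSpace I x →L[ℝ] ℝ) (X Y : VField I N) (p : N) : ℝ :=
  (1 / 2) * (mvfderiv I (fun q => α q (Y q)) p (X p) - mvfderiv I (fun q => α q (X q)) p (Y p)
    - α p (VectorField.mlieBracket I X Y p))

/-- The value at `p` of the exterior derivative of a `2`-form, in the same normalisation:
`3 dΩ(X, Y, Z) = X(Ω(Y, Z)) + Y(Ω(Z, X)) + Z(Ω(X, Y)) - Ω([X, Y], Z) - Ω([Y, Z], X) - Ω([Z, X], Y)`.
-/
def extDerivTwo (Ω : (x : N) → TangentSpace I x → TangentSpace I x → ℝ)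
    (X Y Z : VField I N) (p : N) : ℝ :=
  (1 / 3) * (mvfderiv I (fun q => Ω q (Y q) (Z q)) p (X p)
    + mvfderiv I (fun q => Ω q (Z q) (X q)) p (Y p)
    + mvfderiv I (fun q => Ω q (X q) (Y q)) p (Z p)
    - Ω p (VectorField.mlieBracket I X Y p) (Z p)
    - Ω p (VectorField.mlieBracket I Y Z p) (X p)
    - Ω p (VectorField.mlieBracket I Z X p) (Y p))

variable [IsManifold I ∞ N]

/-- The vector field `X` is of class `C^∞` at (and near) the point `p`. -/
def SmoothFieldAt (X : VField I N) (p : N) : Prop :=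
  ContMDiffAt I I.tangent ∞ (fun x => (⟨x, X x⟩ : TangentBundle I N)) p

variable (I N) in
/-- A `C^∞` Riemannian metric on the manifold `N`. -/
abbrev MetricTensor : Type _ :=
  ContMDiffRiemannianMetric I ∞ E (TangentSpace I : N → Type _)

/-- The length of a tangent vector. -/
def MetricTensor.length (g : MetricTensor I N) {x : N} (v : TangentSpace I x) : ℝ :=
  Real.sqrt (g.inner x v v)

/-- The angle in `[0, π]` between two nonzero tangent vectors. -/
def MetricTensor.angle (g : MetricTensor I N) {x : N} (v w : TangentSpace I x) : ℝ :=
  Real.arccos (g.inner x v w / (MetricTensor.length g v * MetricTensor.length g w))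

/-- `cov` is the Levi-Civita connection of `g`: it is torsion free and metric.
(`cov Y x v` is `∇_v Y`.) -/
structure IsLeviCivita [FiniteDimensional ℝ E] (g : MetricTensor I N)
    (cov : CovariantDerivative I E (TangentSpace I : N → Type _)) : Prop where
  torsion_free : cov.torsion = 0
  metric : ∀ (x : N) (Y Z : VField I N), SmoothFieldAt Y x → SmoothFieldAt Z x →
    ∀ v : TangentSpace I x,
      mvfderiv I (fun q => g.inner q (Y q) (Z q)) x v
        = g.inner x (cov Y x v) (Z x) + g.inner x (Y x) (cov Z x v)

variable (I N) in
/-- An almost contact metric structure `(φ, ξ, η, g)` on the manifold `N`. -/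
structure AlmostContactMetric where
  /-- the `(1,1)`-tensor field -/
  φ : (x : N) → TangentSpace I x →L[ℝ] TangentSpace I x
  /-- the characteristic vector field -/
  ξ : (x : N) → TangentSpace I x
  /-- the `1`-form -/
  η : (x : N) → TangentSpace I x →L[ℝ] ℝ
  /-- the compatible Riemannian metric -/
  g : MetricTensor I N
  smooth_φ : ContMDiff I (I.prod 𝓘(ℝ, E →L[ℝ] E)) ∞
    (fun x => TotalSpace.mk' (E →L[ℝ] E)
      (E := fun y : N => TangentSpace I y →L[ℝ] TangentSpace I y) x (φ x))
  smooth_ξ : ContMDiff I I.tangent ∞ (fun x => (⟨x, ξ x⟩ : TangentBundle I N))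
  smooth_η : ContMDiff I (I.prod 𝓘(ℝ, E →L[ℝ] ℝ)) ∞
    (fun x => TotalSpace.mk' (E →L[ℝ] ℝ)
      (E := fun y : N => TangentSpace I y →L[ℝ] Bundle.Trivial N ℝ y) x (η x))
  φ_sq : ∀ (x : N) (v : TangentSpace I x), φ x (φ x v) = -v + η x v • ξ x
  η_ξ : ∀ x : N, η x (ξ x) = 1
  compatible : ∀ (x : N) (v w : TangentSpace I x),
    g.inner x (φ x v) (φ x w) = g.inner x v w - η x v * η x w

namespace AlmostContactMetric

variable (S : AlmostContactMetric I N)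

/-- The vector field `φ X`. -/
def φField (X : VField I N) : VField I N := fun x => S.φ x (X x)

/-- The fundamental `2`-form `Φ(X, Y) = g(X, φ Y)`. -/
def fundamentalForm (x : N) (v w : TangentSpace I x) : ℝ := S.g.inner x v (S.φ x w)

/-- `φ² [X, Y] + [φ X, φ Y] - φ [φ X, Y] - φ [X, φ Y]`, the Nijenhuis tensor of `φ`. -/
def nijenhuis (X Y : VField I N) (p : N) : TangentSpace I p :=
  S.φ p (S.φ p (VectorField.mlieBracket I X Y p))
    + VectorField.mlieBracket I (S.φField X) (S.φField Y) p
    - S.φ p (VectorField.mlieBracket I (S.φField X) Y p)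
    - S.φ p (VectorField.mlieBracket I X (S.φField Y) p)

/-- Normality: the Nijenhuis tensor plus `2 dη ⊗ ξ` vanishes. -/
def IsNormal : Prop :=
  ∀ (p : N) (X Y : VField I N), SmoothFieldAt X p → SmoothFieldAt Y p →
    S.nijenhuis X Y p + (2 * extDerivOne S.η X Y p) • S.ξ p = 0

/-- Contact metric structures: `Φ = dη`. -/
def IsContact : Prop :=
  ∀ (p : N) (X Y : VField I N), SmoothFieldAt X p → SmoothFieldAt Y p →
    S.fundamentalForm p (X p) (Y p) = extDerivOne S.η X Y p

/-- Almost cosymplectic structures: `η` and `Φ` are closed. -/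
structure IsAlmostCosymplectic : Prop where
  closed_η : ∀ (p : N) (X Y : VField I N), SmoothFieldAt X p → SmoothFieldAt Y p →
    extDerivOne S.η X Y p = 0
  closed_Φ : ∀ (p : N) (X Y Z : VField I N),
    SmoothFieldAt X p → SmoothFieldAt Y p → SmoothFieldAt Z p →
    extDerivTwo S.fundamentalForm X Y Z p = 0

/-- Cosymplectic manifolds: almost cosymplectic and normal. -/
def IsCosymplectic : Prop := S.IsAlmostCosymplectic ∧ S.IsNormal

/-- Sasakian manifolds: contact metric and normal. -/
def IsSasakian : Prop := S.IsContact ∧ S.IsNormal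

/-- Kenmotsu manifolds: `(∇_X φ) Y = g(φ X, Y) ξ - η(Y) φ X`, where `∇` is the given connection
(the Levi-Civita connection of `g` in all uses) and `(∇_X φ) Y = ∇_X (φ Y) - φ (∇_X Y)`. -/
def IsKenmotsu (cov : CovariantDerivative I E (TangentSpace I : N → Type _)) : Prop :=
  ∀ (p : N) (v : TangentSpace I p) (Y : VField I N), SmoothFieldAt Y p →
    cov (S.φField Y) p v - S.φ p (cov Y p v)
      = S.g.inner p (S.φ p v) (Y p) • S.ξ p - S.η p (Y p) • S.φ p v

end AlmostContactMetric

end Ambient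

section Submanifold

variable {E' : Type*} [NormedAddCommGroup E'] [NormedSpace ℝ E']
  {H' : Type*} [TopologicalSpace H'] {J : ModelWithCorners ℝ E' H'}
  {M : Type*} [TopologicalSpace M] [ChartedSpace H' M]
  {E : Type*} [NormedAddCommGroup E] [NormedSpace ℝ E]
  {H : Type*} [TopologicalSpace H] {I : ModelWithCorners ℝ E H}
  {N : Type*} [TopologicalSpace N] [ChartedSpace H N] [IsManifold I ∞ N]

variable (J I) in
/-- `ι : M → N` is a smooth immersion, that is, it makes `M` an (immersed) submanifold of `N`. -/
structure IsSmoothImmersion (ι : M → N) : Prop where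
  smooth : ContMDiff J I ∞ ι
  injective : ∀ p : M, Function.Injective (mfderiv J I ι p)

variable (J) in
/-- The induced metric `(u, v) ↦ g(dι u, dι v)` on `M` at `p`, as a map from `T_p M` to its dual. -/
def inducedMetric (g : MetricTensor I N) (ι : M → N) (p : M) :
    TangentSpace J p →L[ℝ] TangentSpace J p →L[ℝ] ℝ :=
  (ContinuousLinearMap.precomp ℝ (mfderiv J I ι p)).comp
    ((g.inner (ι p)).comp (mfderiv J I ι p))

variable (J) in
/-- The tangential part of `w ∈ T_{ι p} N`: the `v ∈ T_p M` such that
`g(dι v, dι u) = g(w, dι u)` for all `u ∈ T_p M`. -/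
def tanPart (g : MetricTensor I N) (ι : M → N) (p : M) (w : TangentSpace I (ι p)) :
    TangentSpace J p :=
  (inducedMetric J g ι p).inverse ((g.inner (ι p) w).comp (mfderiv J I ι p))

variable (J) in
/-- The normal part of `w ∈ T_{ι p} N`. -/
def norPart (g : MetricTensor I N) (ι : M → N) (p : M) (w : TangentSpace I (ι p)) :
    TangentSpace I (ι p) :=
  w - mfderiv J I ι p (tanPart J g ι p w)

/-- The derivative `∇_u W` at `p` of a vector field `W` along `ι : M → N`, for the connection
`cov` on `N`, i.e. the pulled back connection on `ι^* TN`. In the local frame `E_i` of `TN` around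
`ι p` given by the preferred trivialization, `W = ∑ w_i (E_i ∘ ι)` and
`∇_u W = ∑ dw_i(u) E_i + ∑ w_i(p) ∇_{dι u} E_i`; the two sums are the two terms below. -/
def covAlong (cov : CovariantDerivative I E (TangentSpace I : N → Type _)) (ι : M → N)
    (W : (q : M) → TangentSpace I (ι q)) (p : M) (u : TangentSpace J p) : TangentSpace I (ι p) :=
  (trivializationAt E (TangentSpace I : N → Type _) (ι p)).symm (ι p)
      (mvfderiv J (fun q => (trivializationAt E (TangentSpace I : N → Type _) (ι p)
        (⟨ι q, W q⟩ : TangentBundle I N)).2) p u)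
    + cov (FiberBundle.extend E (W p)) (ι p) (mfderiv J I ι p u)

/-- The shape operator `A_Z X` at `p`, for `Z` normal and `X` tangent to `M` at `p`: minus the
tangential part of `∇_X Z'` (Weingarten formula), where `Z'` is a normal field along `ι` with value
`Z` at `p`, here the normal part of a local extension of `Z` to `N`. -/
def shapeOperator (g : MetricTensor I N)
    (cov : CovariantDerivative I E (TangentSpace I : N → Type _)) (ι : M → N) (p : M)
    (Z : TangentSpace I (ι p)) (X : TangentSpace J p) : TangentSpace J p :=
  -tanPart J g ι p
    (covAlong cov ι (fun q => norPart J g ι q (FiberBundle.extend E Z (ι q))) p X)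

namespace AlmostContactMetric

variable (S : AlmostContactMetric I N) (ι : M → N)

variable (J) in
/-- `T X`, the tangential part of `φ X`. -/
def tanφ (p : M) (X : TangentSpace J p) : TangentSpace J p :=
  tanPart J S.g ι p (S.φ (ι p) (mfderiv J I ι p X))

variable (J) in
/-- `F X`, the normal part of `φ X`. -/
def norφ (p : M) (X : TangentSpace J p) : TangentSpace I (ι p) :=
  norPart J S.g ι p (S.φ (ι p) (mfderiv J I ι p X))

variable (J) in
/-- The fibre `M_p` of `T¹M` at `p`: the tangent vectors of `M` that are orthogonal to `ξ`. -/
def tangentOne (p : M) : Set (TangentSpace J p) :=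
  {X | S.g.inner (ι p) (mfderiv J I ι p X) (S.ξ (ι p)) = 0}

variable (J) in
/-- `M` is a pointwise slant submanifold with slant function `θ`: for each `p` and each nonzero
`X ∈ M_p`, the angle between `φ X` and the space `M_p` (the least angle between `φ X` and a nonzero
vector of `M_p`) is `θ p`. -/
def IsPointwiseSlant (θ : M → ℝ) : Prop :=
  ∀ (p : M) (X : TangentSpace J p), X ∈ S.tangentOne J ι p → X ≠ 0 →
    IsLeast {α : ℝ | ∃ Y : TangentSpace J p, Y ∈ S.tangentOne J ι p ∧ Y ≠ 0 ∧
      α = MetricTensor.angle S.g (S.φ (ι p) (mfderiv J I ι p X)) (mfderiv J I ι p Y)} (θ p)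

variable (J) in
/-- `M` is a slant submanifold with slant angle `θ`: pointwise slant with constant slant
function. -/
def IsSlant (θ : ℝ) : Prop := S.IsPointwiseSlant J ι (fun _ => θ)

end AlmostContactMetric

end Submanifold

end SlantGeometry

end

/-! Write `D` for the derivative along `ι`, and let `c = cos² θ`. Three facts carry the proof.

The ambient structure enters only through `g((∇_u φ)v, w) = 0` for `v, w ⊥ ξ` and arbitrary `u`. For
Kenmotsu manifolds this is read off the definition. In the other two cases `Φ` is closed (for
Sasakian ones because `Φ = dη` is exact), so the cyclic sum of `∇φ` vanishes; combined with
normality and the derivatives of `φ² = -I + η ⊗ ξ` and of the skewness of `φ`, this kills `∇φ` on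
`ker η` (`IsNormal.inner_covφ_eq_zero`).

The slant condition gives `|TX|² = c |X|²` on `M_p`, and hence `T² = -c` there, since `T` is skew
and preserves `M_p` (`inner_tanφ_self`, `tanφ_tanφ`).

If `cos θ ≠ 0`, every `X ∈ M_p` extends to a field `V` with values in `T¹M` near `p`
(`exists_diffFieldAt_tangentOne`). The danger is a point where `ξ` is normal to `M` without being so
nearby, so that `dim M_p` jumps by one. This cannot happen, because `T² = -c` forces every `M_p` to
have even dimension.

For `u` tangent, self-adjointness of the shape operator and the Weingarten formula give `g(A_{FX}
TX, u) = -g(D_u FV, TX)`. With `FV = φV - TV`, the first fact and the skewness of `φ`, this equals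
`g(D_u V, φTX) + g(D_u TV, TX)`. As `φTX = -cX + FTX`, it is `g(D_u V, FTX) + ½ u(|TV|² - c|V|²)`.
The last term is zero, and the first is `g(A_{FTX} X, u)`. If `cos θ = 0`, then `T = 0` on `M_p` and
both sides vanish. -/

noncomputable section

namespace SlantGeometry

open FiberBundle

/-! ### Algebra of almost contact metric structures. -/

section Ambient

variable {E : Type*} [NormedAddCommGroup E] [NormedSpace ℝ E]
  {H : Type*} [TopologicalSpace H] {I : ModelWithCorners ℝ E H}
  {N : Type*} [TopologicalSpace N] [ChartedSpace H N] [IsManifold I ∞ N]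

/-- Differentiability at `p` of a vector field on `N`. -/
def DiffFieldAt (X : VField I N) (p : N) : Prop :=
  MDifferentiableAt I I.tangent (fun x => (⟨x, X x⟩ : TangentBundle I N)) p

theorem SmoothFieldAt.diffFieldAt {X : VField I N} {p : N} (hX : SmoothFieldAt X p) :
    DiffFieldAt X p :=
  ContMDiffAt.mdifferentiableAt hX (by simp)

theorem smoothFieldAt_extend {p : N} (v : TangentSpace I p) :
    SmoothFieldAt (I := I) (extend E v) p :=
  contMDiffAt_extend I E v

theorem diffFieldAt_extend {p : N} (v : TangentSpace I p) :
    DiffFieldAt (I := I) (extend E v) p :=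
  (smoothFieldAt_extend v).diffFieldAt

namespace AlmostContactMetric

variable (S : AlmostContactMetric I N)

/-- Since `φ²ξ = 0`, the formula for `φ²` applied to `φξ` makes `φξ` a multiple `c ξ`; applying `φ`
once more gives `c² = 0`. -/
theorem φ_ξ (x : N) : S.φ x (S.ξ x) = 0 := by
  have h1 : S.φ x (S.φ x (S.ξ x)) = 0 := by rw [S.φ_sq, S.η_ξ]; simp
  have h2 := S.φ_sq x (S.φ x (S.ξ x))
  rw [h1, map_zero] at h2
  set c := S.η x (S.φ x (S.ξ x)) with hc
  have h3 : S.φ x (S.ξ x) = c • S.ξ x := by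
    rw [neg_add_eq_sub] at h2
    exact (sub_eq_zero.1 h2.symm).symm
  have h4 : (c * c) • S.ξ x = 0 := by
    rw [← h1, h3, map_smul, h3, smul_smul]
  have h5 : c * c = 0 := by
    have := congrArg (S.η x) h4
    rw [map_smul, S.η_ξ] at this
    simpa using this
  rw [h3, mul_self_eq_zero.1 h5, zero_smul]

theorem η_eq_inner (x : N) (v : TangentSpace I x) : S.η x v = S.g.inner x v (S.ξ x) := by
  have h := S.compatible x v (S.ξ x)
  rw [S.φ_ξ, map_zero, S.η_ξ] at h
  linarith

theorem η_φ (x : N) (v : TangentSpace I x) : S.η x (S.φ x v) = 0 := by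
  have h1 := S.φ_sq x (S.φ x v)
  rw [S.φ_sq x v, map_add, map_smul, S.φ_ξ, smul_zero, add_zero, map_neg] at h1
  have h2 : S.η x (S.φ x v) • S.ξ x = 0 := by
    have := (add_eq_left (a := -(S.φ x) v)).1 h1.symm
    exact this
  have := congrArg (S.η x) h2
  rw [map_smul, S.η_ξ] at this
  simpa using this

/-- Compatibility applied to `φv` and `w`, with `φ²` expanded; the `ξ`-term drops because `η ∘ φ =
0`. -/
theorem inner_φ_left (x : N) (v w : TangentSpace I x) :
    S.g.inner x (S.φ x v) w = -S.g.inner x v (S.φ x w) := by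
  have h := S.compatible x (S.φ x v) w
  rw [S.φ_sq, S.η_φ, map_add, map_smul, map_neg] at h
  have h2 : S.g.inner x (S.ξ x) (S.φ x w) = 0 := by
    rw [S.g.symm, ← S.η_eq_inner, S.η_φ]
  simp only [add_apply, neg_apply,
    smul_apply, h2] at h
  simp at h
  linarith

theorem inner_φ_ξ (x : N) (v : TangentSpace I x) : S.g.inner x (S.φ x v) (S.ξ x) = 0 := by
  rw [← S.η_eq_inner, S.η_φ]

theorem inner_φ_φ_sq (x : N) (u w : TangentSpace I x) :
    S.g.inner x u (S.φ x (S.φ x w)) = -S.g.inner x u w + S.η x w * S.η x u := by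
  rw [S.φ_sq, map_add, map_neg, map_smul, ← S.η_eq_inner, smul_eq_mul]

variable {S}

theorem smoothFieldAt_φField {Y : VField I N} {p : N} (hY : SmoothFieldAt Y p) :
    SmoothFieldAt (S.φField Y) p :=
  ContMDiffAt.clm_bundle_apply (b := fun x : N => x) (S.smooth_φ p) hY

theorem diffFieldAt_φField {Y : VField I N} {p : N} (hY : DiffFieldAt Y p) :
    DiffFieldAt (S.φField Y) p :=
  MDifferentiableAt.clm_bundle_apply (b := fun x : N => x)
    ((S.smooth_φ p).mdifferentiableAt (by simp)) hY

theorem smoothFieldAt_ξ (p : N) : SmoothFieldAt S.ξ p := S.smooth_ξ p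

end AlmostContactMetric

theorem contMDiffAt_inner (g : MetricTensor I N) {Y Z : VField I N} {p : N}
    (hY : SmoothFieldAt Y p) (hZ : SmoothFieldAt Z p) :
    ContMDiffAt I 𝓘(ℝ) ∞ (fun q => g.inner q (Y q) (Z q)) p := by
  have := ContMDiffAt.clm_bundle_apply₂ (b := fun x : N => x) (F₁ := E) (F₂ := E) (F₃ := ℝ)
    (E₃ := fun _ : N => ℝ) (g.contMDiff p) hY hZ
  exact (contMDiffAt_totalSpace.1 this).2

end Ambient

/-! ### The tensor `∇φ` and the constraints of normality. -/

section Ambient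

variable {E : Type*} [NormedAddCommGroup E] [NormedSpace ℝ E]
  {H : Type*} [TopologicalSpace H] {I : ModelWithCorners ℝ E H}
  {N : Type*} [TopologicalSpace N] [ChartedSpace H N] [IsManifold I ∞ N]
  {cov : CovariantDerivative I E (TangentSpace I : N → Type _)}

theorem mdifferentiableAt_inner (g : MetricTensor I N) {Y Z : VField I N} {p : N}
    (hY : SmoothFieldAt Y p) (hZ : SmoothFieldAt Z p) :
    MDifferentiableAt I 𝓘(ℝ) (fun q => g.inner q (Y q) (Z q)) p :=
  (contMDiffAt_inner g hY hZ).mdifferentiableAt (by simp)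

theorem IsLeviCivita.lieBracket_eq [FiniteDimensional ℝ E] {g : MetricTensor I N}
    (h : IsLeviCivita g cov)
    {X Y : VField I N} {p : N} (hX : DiffFieldAt X p) (hY : DiffFieldAt Y p) :
    VectorField.mlieBracket I X Y p = cov Y p (X p) - cov X p (Y p) :=
  (cov.torsion_eq_zero_iff.1 h.torsion_free hX hY).symm

namespace AlmostContactMetric

variable (S : AlmostContactMetric I N)

/-- The two `df` terms of the Leibniz rule cancel, so the value depends on `Y` only at `p` and the
extension chosen in `covφ` is immaterial. -/
theorem tensorialAt_cov_φField (p : N) (v : TangentSpace I p) :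
    TensorialAt I E (fun Y : VField I N => cov (S.φField Y) p v - S.φ p (cov Y p v)) p where
  smul {f Y} hf hY := by
    have h1 : S.φField (f • Y) = f • S.φField Y := by
      ext x; simp [φField]
    have hφ : DiffFieldAt (S.φField Y) p := diffFieldAt_φField hY
    simp only [h1]
    rw [cov.isCovariantDerivativeOn.leibniz hφ hf, cov.isCovariantDerivativeOn.leibniz hY hf]
    simp [φField, smul_sub]
  add {Y Y'} hY hY' := by
    have h1 : S.φField (Y + Y') = S.φField Y + S.φField Y' := by
      ext x; simp [φField]
    simp only [h1]
    rw [cov.isCovariantDerivativeOn.add (diffFieldAt_φField hY) (diffFieldAt_φField hY'),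
      cov.isCovariantDerivativeOn.add hY hY']
    simp only [add_apply, map_add]
    abel

variable (cov) in
/-- The tensor `(v, w) ↦ (∇_v φ) w`. -/
def covφ (p : N) (v w : TangentSpace I p) : TangentSpace I p :=
  cov (S.φField (extend E w)) p v - S.φ p (cov (extend E w) p v)

variable {S}

theorem cov_φField [FiniteDimensional ℝ E] {Y : VField I N} {p : N} (hY : DiffFieldAt Y p)
    (v : TangentSpace I p) :
    cov (S.φField Y) p v = S.covφ cov p v (Y p) + S.φ p (cov Y p v) := by
  have h := (S.tensorialAt_cov_φField (cov := cov) p v).pointwise hY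
    (diffFieldAt_extend (Y p)) (by simp)
  rw [covφ, ← h]
  abel

/-- The derivative of the skewness relation `g(φY, Z) = -g(Y, φZ)`. -/
theorem inner_covφ_skew [FiniteDimensional ℝ E] (hcov : IsLeviCivita S.g cov) (p : N)
    (v w z : TangentSpace I p) :
    S.g.inner p (S.covφ cov p v w) z = -S.g.inner p (S.covφ cov p v z) w := by
  have hw := smoothFieldAt_extend (I := I) w
  have hz := smoothFieldAt_extend (I := I) z
  have h1 := hcov.metric p _ _ (smoothFieldAt_φField (S := S) hw) hz v
  have h2 := hcov.metric p _ _ hw (smoothFieldAt_φField (S := S) hz) v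
  have h3 : (fun q => S.g.inner q (S.φField (extend E w) q) (extend E z q))
      = -(fun q => S.g.inner q (extend E w q) (S.φField (extend E z) q)) := by
    ext q; simp [φField, S.inner_φ_left]
  rw [h3, mvfderiv_neg, neg_apply, h2, cov_φField hw.diffFieldAt, cov_φField hz.diffFieldAt] at h1
  simp only [φField, extend_apply_self, map_add, add_apply, S.inner_φ_left] at h1
  rw [S.g.symm p (S.covφ cov p v z) w]
  linarith

/-- `η(Y)` is differentiated by means of `∇ξ`. -/
theorem mvfderiv_η [FiniteDimensional ℝ E] (hcov : IsLeviCivita S.g cov) {Y : VField I N} {p : N}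
    (hY : SmoothFieldAt Y p) (v : TangentSpace I p) :
    mvfderiv I (fun q => S.η q (Y q)) p v
      = S.η p (cov Y p v) + S.g.inner p (cov S.ξ p v) (Y p) := by
  simp only [S.η_eq_inner]
  rw [hcov.metric p _ _ hY (smoothFieldAt_ξ p) v, S.g.symm p (Y p)]

/-- The derivative of `φ² = -I + η ⊗ ξ`. -/
theorem covφ_φ [FiniteDimensional ℝ E] (hcov : IsLeviCivita S.g cov) (p : N)
    (v w : TangentSpace I p) :
    S.covφ cov p v (S.φ p w) = S.g.inner p (cov S.ξ p v) w • S.ξ p + S.η p w • cov S.ξ p v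
      - S.φ p (S.covφ cov p v w) := by
  have hw := smoothFieldAt_extend (I := I) w
  have hφ := smoothFieldAt_φField (S := S) hw
  have h1 := cov_φField (S := S) (cov := cov) hφ.diffFieldAt v
  have h2 : S.φField (S.φField (extend E w))
      = (fun _ : N => (-1 : ℝ)) • extend E w + (fun q => S.η q (extend E w q)) • S.ξ := by
    ext q; simp [φField, S.φ_sq]
  have hη : MDifferentiableAt I 𝓘(ℝ) (fun q => S.η q (extend E w q)) p := by
    simp only [S.η_eq_inner]
    exact mdifferentiableAt_inner S.g hw (smoothFieldAt_ξ p)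
  have hc : MDifferentiableAt I 𝓘(ℝ) (fun _ : N => (-1 : ℝ)) p := mdifferentiableAt_const
  have hξ : DiffFieldAt S.ξ p := (smoothFieldAt_ξ p).diffFieldAt
  rw [h2, cov.isCovariantDerivativeOn.add (hc.smul_section hw.diffFieldAt)
      (hη.smul_section hξ), cov.isCovariantDerivativeOn.leibniz hw.diffFieldAt hc,
    cov.isCovariantDerivativeOn.leibniz hξ hη, cov_φField hw.diffFieldAt] at h1
  simp only [mvfderiv_const, φField, extend_apply_self, add_apply, smul_apply, map_add,
    ContinuousLinearMap.smulRight_apply, zero_apply, S.φ_sq, mvfderiv_η hcov hw] at h1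
  rw [eq_sub_iff_add_eq]
  rw [add_smul] at h1
  simp only [zero_smul, add_zero, neg_smul, one_smul] at h1
  have h3 := congrArg (fun t => t + cov (extend E w) p v - S.η p (cov (extend E w) p v) • S.ξ p) h1
  calc _ = _ := ?_
    _ = _ := h3.symm
    _ = _ := ?_
  · abel
  · abel

/-- The exterior derivative of `η` is the skew part of `∇ξ`. -/
theorem two_mul_extDerivOne_η [FiniteDimensional ℝ E] (hcov : IsLeviCivita S.g cov)
    {X Y : VField I N} {p : N} (hX : SmoothFieldAt X p)
    (hY : SmoothFieldAt Y p) :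
    2 * extDerivOne S.η X Y p
      = S.g.inner p (cov S.ξ p (X p)) (Y p) - S.g.inner p (cov S.ξ p (Y p)) (X p) := by
  rw [extDerivOne, mvfderiv_η hcov hX, mvfderiv_η hcov hY,
    hcov.lieBracket_eq hX.diffFieldAt hY.diffFieldAt, map_sub]
  ring

/-- Normality in terms of the covariant derivatives of `φ` and `ξ`. -/
theorem IsNormal.covφ_eq [FiniteDimensional ℝ E] (hcov : IsLeviCivita S.g cov) (hS : S.IsNormal)
    (p : N) (x y : TangentSpace I p) :
    S.covφ cov p (S.φ p x) y - S.covφ cov p (S.φ p y) x - S.φ p (S.covφ cov p x y)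
      + S.φ p (S.covφ cov p y x)
      + (S.g.inner p (cov S.ξ p x) y - S.g.inner p (cov S.ξ p y) x) • S.ξ p = 0 := by
  have hx := smoothFieldAt_extend (I := I) x
  have hy := smoothFieldAt_extend (I := I) y
  have hφx := smoothFieldAt_φField (S := S) hx
  have hφy := smoothFieldAt_φField (S := S) hy
  have h := hS p _ _ hx hy
  rw [two_mul_extDerivOne_η hcov hx hy, nijenhuis,
    hcov.lieBracket_eq hx.diffFieldAt hy.diffFieldAt,
    hcov.lieBracket_eq hφx.diffFieldAt hφy.diffFieldAt,
    hcov.lieBracket_eq hφx.diffFieldAt hy.diffFieldAt,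
    hcov.lieBracket_eq hx.diffFieldAt hφy.diffFieldAt,
    cov_φField hx.diffFieldAt, cov_φField hx.diffFieldAt,
    cov_φField hy.diffFieldAt, cov_φField hy.diffFieldAt] at h
  simp only [φField, extend_apply_self, map_sub, map_add] at h
  rw [← h]
  abel

/-- The exterior derivative of the fundamental form, in terms of `∇φ`, for commuting fields. -/
theorem sum_mvfderiv_fundamentalForm [FiniteDimensional ℝ E] (hcov : IsLeviCivita S.g cov)
    {X Y Z : VField I N} {p : N}
    (hX : SmoothFieldAt X p) (hY : SmoothFieldAt Y p) (hZ : SmoothFieldAt Z p)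
    (hXY : VectorField.mlieBracket I X Y p = 0) (hYZ : VectorField.mlieBracket I Y Z p = 0)
    (hZX : VectorField.mlieBracket I Z X p = 0) :
    mvfderiv I (fun q => S.fundamentalForm q (Y q) (Z q)) p (X p)
      + mvfderiv I (fun q => S.fundamentalForm q (Z q) (X q)) p (Y p)
      + mvfderiv I (fun q => S.fundamentalForm q (X q) (Y q)) p (Z p)
    = -(S.g.inner p (S.covφ cov p (X p) (Y p)) (Z p) + S.g.inner p (S.covφ cov p (Y p) (Z p)) (X p)
      + S.g.inner p (S.covφ cov p (Z p) (X p)) (Y p)) := by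
  have key : ∀ {Y Z : VField I N} (v : TangentSpace I p), SmoothFieldAt Y p → SmoothFieldAt Z p →
      mvfderiv I (fun q => S.fundamentalForm q (Y q) (Z q)) p v
        = S.g.inner p (cov Y p v) (S.φ p (Z p)) - S.g.inner p (cov Z p v) (S.φ p (Y p))
          - S.g.inner p (S.covφ cov p v (Y p)) (Z p) := by
    intro Y Z v hY hZ
    have := hcov.metric p _ _ hY (smoothFieldAt_φField (S := S) hZ) v
    rw [cov_φField hZ.diffFieldAt] at this
    simp only [φField, map_add] at this
    simp only [fundamentalForm]
    rw [this, inner_covφ_skew hcov p v (Y p), S.g.symm p (cov Z p v), S.inner_φ_left,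
      S.g.symm p (Y p) (S.covφ cov p v (Z p))]
    ring
  rw [hcov.lieBracket_eq hX.diffFieldAt hY.diffFieldAt, sub_eq_zero] at hXY
  rw [hcov.lieBracket_eq hY.diffFieldAt hZ.diffFieldAt, sub_eq_zero] at hYZ
  rw [hcov.lieBracket_eq hZ.diffFieldAt hX.diffFieldAt, sub_eq_zero] at hZX
  rw [key _ hY hZ, key _ hZ hX, key _ hX hY, hXY, hYZ, hZX]
  ring

/-- If the fundamental form is closed and the structure is normal, then `∇φ` vanishes on pairs of
vectors orthogonal to `ξ`, provided that `dη(φ y, z)` is symmetric for those. -/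
theorem IsNormal.inner_covφ_eq_zero [FiniteDimensional ℝ E] (hcov : IsLeviCivita S.g cov)
    (hS : S.IsNormal) (p : N)
    (hΦ : ∀ x y z : TangentSpace I p, S.g.inner p (S.covφ cov p x y) z
      + S.g.inner p (S.covφ cov p y z) x + S.g.inner p (S.covφ cov p z x) y = 0)
    (hd : ∀ y z : TangentSpace I p, S.η p y = 0 → S.η p z = 0 →
      S.g.inner p (cov S.ξ p (S.φ p y)) z - S.g.inner p (cov S.ξ p z) (S.φ p y)
        = S.g.inner p (cov S.ξ p (S.φ p z)) y - S.g.inner p (cov S.ξ p y) (S.φ p z))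
    {x y z : TangentSpace I p} (hy : S.η p y = 0) (hz : S.η p z = 0) :
    S.g.inner p (S.covφ cov p x y) z = 0 := by
  have skew := inner_covφ_skew (S := S) hcov p
  -- Moving `φ` across `∇_v φ` costs only terms in `∇ξ`; this is `covφ_φ` paired with `u`.
  have R : ∀ v w u : TangentSpace I p, S.g.inner p (S.covφ cov p v (S.φ p w)) u
      = S.g.inner p (cov S.ξ p v) w * S.η p u + S.η p w * S.g.inner p (cov S.ξ p v) u
        + S.g.inner p (S.covφ cov p v w) (S.φ p u) := by
    intro v w u
    rw [covφ_φ hcov, S.η_eq_inner p u, S.g.symm p u]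
    simp only [map_sub, map_add, map_smul, sub_apply, add_apply, smul_apply, smul_eq_mul,
      S.inner_φ_left]
    ring
  -- Pairing normality with `φx` removes its `ξ`-component. Subtracting the cyclic identities `c1`
  -- at `(x, φy, φz)` and `c2` at `(x, y, z)` doubles `g((∇_x φ)y, z)`, because `r1` turns the first
  -- term of `c1` into its negative; the remaining terms cancel by `hN` and `hd`.
  have hN := congrArg (fun t => S.g.inner p t (S.φ p x)) (hS.covφ_eq hcov p y z)
  simp only [map_sub, map_add, map_smul, map_zero, sub_apply, add_apply, smul_apply, zero_apply,
    smul_eq_mul, S.inner_φ_left p (S.covφ cov p _ _), S.inner_φ_φ_sq] at hN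
  rw [S.g.symm p (S.ξ p), S.inner_φ_ξ] at hN
  have c1 := hΦ x (S.φ p y) (S.φ p z)
  have c2 := hΦ x y z
  have r1 := R x y (S.φ p z)
  rw [S.inner_φ_φ_sq, S.η_φ, hz, hy] at r1
  have r2 := R (S.φ p y) z x
  have s2 := skew (S.φ p y) (S.φ p z) x
  rw [hz] at r2
  have r3 := R (S.φ p z) y x
  have s3 := skew (S.φ p z) x (S.φ p y)
  rw [hy] at r3
  have e1 := R y (S.φ p z) (S.ξ p)
  rw [S.φ_sq, hz, zero_smul, add_zero, S.η_φ, S.η_ξ, S.φ_ξ, map_zero] at e1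
  have e2 := R z (S.φ p y) (S.ξ p)
  rw [S.φ_sq, hy, zero_smul, add_zero, S.η_φ, S.η_ξ, S.φ_ξ, map_zero] at e2
  -- Skewness moves the sign of `-z` from the argument of `∇φ` into a slot of the metric, where
  -- linearity is available.
  have f1 := skew y (-z) (S.ξ p)
  have f2 := skew z (-y) (S.ξ p)
  have f1' := skew y z (S.ξ p)
  have f2' := skew z y (S.ξ p)
  simp only [map_neg] at f1 f2
  have hd' := hd y z hy hz
  have s4 := skew z x y
  have hη1 := S.η_eq_inner p (S.covφ cov p y z)
  have hη2 := S.η_eq_inner p (S.covφ cov p z y)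
  rw [hη1, hη2] at hN
  have g1 : S.g.inner p (S.covφ cov p y z) (S.ξ p) = - S.g.inner p (cov S.ξ p y) (S.φ p z) := by
    rw [f1']; linarith
  have g2 : S.g.inner p (S.covφ cov p z y) (S.ξ p) = - S.g.inner p (cov S.ξ p z) (S.φ p y) := by
    rw [f2']; linarith
  rw [g1, g2] at hN
  -- The `∇ξ` terms occur multiplied by `η x`, so `hd'` is needed in this multiplied form.
  have hmul := congrArg (fun t => S.η p x * t) hd'
  simp only [mul_sub] at hmul
  linarith

end AlmostContactMetric

end Ambient

/-! ### Coordinate fields and second derivatives. -/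

section Charts

open Filter Topology

variable {E : Type*} [NormedAddCommGroup E] [NormedSpace ℝ E]
  {H : Type*} [TopologicalSpace H] {I : ModelWithCorners ℝ E H}
  {N : Type*} [TopologicalSpace N] [ChartedSpace H N] [IsManifold I ∞ N]

theorem eventually_mem_chart_source (p : N) : ∀ᶠ q in 𝓝 p, q ∈ (chartAt H p).source :=
  (chartAt H p).open_source.mem_nhds (mem_chart_source H p)

/-- Fields `extend v` are thereby identified with coordinate fields: their image under the
derivative of the chart is constant. -/
theorem trivializationAt_snd_eq_mfderiv {p q : N} (hq : q ∈ (chartAt H p).source)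
    (w : TangentSpace I q) :
    (trivializationAt E (TangentSpace I : N → Type _) p (⟨q, w⟩ : TangentBundle I N)).2
      = mfderiv I 𝓘(ℝ, E) (extChartAt I p) q w := by
  rw [← TangentBundle.continuousLinearMapAt_trivializationAt hq]
  exact ((trivializationAt E (TangentSpace I : N → Type _) p).continuousLinearMapAt_apply_of_mem
    ℝ hq w).symm

theorem trivializationAt_extend {p q : N} (hq : q ∈ (chartAt H p).source)
    (v : TangentSpace I p) :
    (trivializationAt E (TangentSpace I : N → Type _) p
      (⟨q, extend E v q⟩ : TangentBundle I N)).2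
      = (trivializationAt E (TangentSpace I : N → Type _) p (⟨p, v⟩ : TangentBundle I N)).2 := by
  rw [extend, Trivialization.apply_mk_symm _ (by exact hq)]

theorem smoothFieldAt_extend_of_mem {p q : N} (hq : q ∈ (chartAt H p).source)
    (v : TangentSpace I p) : SmoothFieldAt (I := I) (extend E v) q := by
  set t := trivializationAt E (TangentSpace I : N → Type _) p
  have h : ContMDiffAt I 𝓘(ℝ, E) ∞
      (fun x => (t (⟨x, extend E v x⟩ : TangentBundle I N)).2) q := by
    refine (contMDiffAt_const (c := (t (⟨p, v⟩ : TangentBundle I N)).2)).congr_of_eventuallyEq ?_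
    filter_upwards [(chartAt H p).open_source.mem_nhds hq] with x hx
    exact trivializationAt_extend hx v
  exact (t.contMDiffAt_section_iff (s := extend E v) (by exact hq)).2 h

theorem two_le_infty : (2 : WithTop ℕ∞) ≤ ∞ := by
  exact WithTop.coe_le_coe.2 (le_top : (2 : ℕ∞) ≤ ⊤)

/-- The constant vector field on a vector space. -/
def constField (e : E) (x : E) : TangentSpace 𝓘(ℝ, E) x := e

theorem mdifferentiableAt_constField (e y : E) :
    MDifferentiableAt 𝓘(ℝ, E) 𝓘(ℝ, E).tangent
      (fun x => (⟨x, constField e x⟩ : TangentBundle 𝓘(ℝ, E) E)) y :=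
  ((contMDiffAt_vectorSpace_iff_contDiffAt (n := 1) (V := constField e)).2
    contDiffAt_const).mdifferentiableAt (by simp)

/-- The local fields `extend v` are coordinate fields, so they commute. -/
theorem mlieBracket_extend [CompleteSpace E] {p q : N} (hq : q ∈ (chartAt H p).source)
    (v w : TangentSpace I p) :
    VectorField.mlieBracket I (extend E v) (extend E w) q = 0 := by
  set t := trivializationAt E (TangentSpace I : N → Type _) p with ht
  -- Near `q` the field is the chart pullback of a constant field, and pullback respects brackets.
  have key : ∀ u : TangentSpace I p, (extend E u : VField I N) =ᶠ[𝓝 q]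
      VectorField.mpullback I 𝓘(ℝ, E) (extChartAt I p)
        (constField (t (⟨p, u⟩ : TangentBundle I N)).2) := by
    intro u
    filter_upwards [(chartAt H p).open_source.mem_nhds hq] with x hx
    have hinv := isInvertible_mfderiv_extChartAt (I := I) (x := p) (y := x)
      (by rwa [extChartAt_source])
    have h1 := trivializationAt_extend hx u
    rw [trivializationAt_snd_eq_mfderiv hx] at h1
    change extend E u x = (mfderiv I 𝓘(ℝ, E) (extChartAt I p) x).inverse
      (t (⟨p, u⟩ : TangentBundle I N)).2
    rw [ht, ← h1]
    exact (hinv.inverse_apply_eq.2 rfl).symm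
  have h0 : VectorField.mlieBracket 𝓘(ℝ, E)
      (constField (t (⟨p, v⟩ : TangentBundle I N)).2)
      (constField (t (⟨p, w⟩ : TangentBundle I N)).2) = 0 := by
    rw [← VectorField.mlieBracketWithin_univ, VectorField.mlieBracketWithin_eq_lieBracketWithin]
    ext x
    have hc : ∀ e : E, fderivWithin ℝ (constField e) Set.univ x = 0 :=
      fun e => fderivWithin_const_apply e
    simp only [VectorField.lieBracketWithin, hc]
    exact sub_self (0 : E)
  have : IsManifold I (minSmoothness ℝ 2) N :=
    IsManifold.of_le (n := ∞) (by simpa using two_le_infty)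
  rw [(key v).mlieBracket_vectorField_eq (key w), ← VectorField.mpullback_mlieBracket (n := ∞)]
  · rw [h0]; simp [VectorField.mpullback_apply]
  · exact mdifferentiableAt_constField _ _
  · exact mdifferentiableAt_constField _ _
  · exact contMDiffAt_extChartAt' hq
  · simpa using two_le_infty

/-- The second derivative along coordinate fields is given by a symmetric bilinear map. -/
theorem exists_symm_mvfderiv_mvfderiv_extend [I.Boundaryless] {F : Type*} [NormedAddCommGroup F]
    [NormedSpace ℝ F] {f : N → F} {p : N} (hf : ContMDiffAt I 𝓘(ℝ, F) ∞ f p) :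
    ∃ B : E → E → F, (∀ a b, B a b = B b a) ∧ ∀ v : TangentSpace I p,
      MDifferentiableAt I 𝓘(ℝ, F) (fun q => mvfderiv I f q (extend E v q)) p ∧
      ∀ u : TangentSpace I p, mvfderiv I (fun q => mvfderiv I f q (extend E v q)) p u = B u v := by
  set c := extChartAt I p with hc
  set G : E → F := f ∘ c.symm with hG
  set t := trivializationAt E (TangentSpace I : N → Type _) p with ht
  have hGs : ContDiffAt ℝ ∞ G (c p) := by
    have h1 := (contMDiffAt_iff.1 hf).2
    simp only [I.range_eq_univ, contDiffWithinAt_univ] at h1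
    exact h1
  -- In the chart, differentiating along `extend w` is differentiating `G` in a constant direction.
  -- The bilinear map is therefore the second derivative of `G`.
  have hev : ∀ᶠ q in 𝓝 p, ∀ w : TangentSpace I p,
      mvfderiv I f q (extend E w q) = fderiv ℝ G (c q) (t (⟨p, w⟩ : TangentBundle I N)).2 := by
    have hcc : ContinuousAt c p := continuousAt_extChartAt p
    have h1 : ∀ᶠ y in 𝓝 (c p), ContDiffAt ℝ 1 G y :=
      (hGs.of_le (by simp)).eventually (by simp)
    filter_upwards [hcc.eventually h1, eventually_mem_chart_source (H := H) p] with q hq hqs w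
    have hm : HasMFDerivAt I 𝓘(ℝ, E) c q (mfderiv I 𝓘(ℝ, E) c q) :=
      (mdifferentiableAt_extChartAt hqs).hasMFDerivAt
    have hGd : HasMFDerivAt 𝓘(ℝ, E) 𝓘(ℝ, F) G (c q) (fderiv ℝ G (c q)) :=
      (hq.differentiableAt (by simp)).hasFDerivAt.hasMFDerivAt
    have hcomp := hGd.comp q hm
    have heq : f =ᶠ[𝓝 q] G ∘ c := by
      filter_upwards [(chartAt H p).open_source.mem_nhds hqs] with x hx
      simp only [hG, Function.comp_apply]
      rw [c.left_inv (by rwa [hc, extChartAt_source])]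
    have hfd := (hcomp.congr_of_eventuallyEq heq).mfderiv
    have h2 := trivializationAt_extend hqs w
    rw [trivializationAt_snd_eq_mfderiv hqs] at h2
    rw [ht, ← h2]
    change mfderiv I 𝓘(ℝ, F) f q (extend E w q) = _
    rw [hfd]
    rfl
  have hD : DifferentiableAt ℝ (fderiv ℝ G) (c p) :=
    ((hGs.fderiv_right (m := 1) (by rw [one_add_one_eq_two]; exact two_le_infty)).differentiableAt
      (by simp))
  have ht_self : ∀ a : TangentSpace I p, (t (⟨p, a⟩ : TangentBundle I N)).2 = a := by
    intro a
    rw [ht, trivializationAt_snd_eq_mfderiv (mem_chart_source H p) a, mfderiv_extChartAt_self]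
    rfl
  refine ⟨fun a b => fderiv ℝ (fderiv ℝ G) (c p) a b,
    fun a b => hGs.isSymmSndFDerivAt (by simpa using two_le_infty) a b, fun b => ?_⟩
  have hm : HasMFDerivAt I 𝓘(ℝ, E) c p (mfderiv I 𝓘(ℝ, E) c p) :=
    (mdifferentiableAt_extChartAt (mem_chart_source H p)).hasMFDerivAt
  have hK : HasFDerivAt (fun y => fderiv ℝ G y (t (⟨p, b⟩ : TangentBundle I N)).2)
      ((fderiv ℝ (fderiv ℝ G) (c p)).flip (t (⟨p, b⟩ : TangentBundle I N)).2) (c p) := by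
    have := hD.hasFDerivAt.clm_apply
      (hasFDerivAt_const (t (⟨p, b⟩ : TangentBundle I N)).2 (c p))
    convert this using 1
    ext; simp
  have h3 := hK.hasMFDerivAt.comp p hm
  have heq : (fun q => mvfderiv I f q (extend E b q))
      =ᶠ[𝓝 p] (fun y => fderiv ℝ G y (t (⟨p, b⟩ : TangentBundle I N)).2) ∘ c := by
    filter_upwards [hev] with q hq using hq b
  have h4 := h3.congr_of_eventuallyEq heq
  refine ⟨h4.mdifferentiableAt, fun a => ?_⟩
  change mfderiv I 𝓘(ℝ, F) _ p a = _
  rw [h4.mfderiv, hc, mfderiv_extChartAt_self, ht_self]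
  rfl

/-- Symmetry of the second derivative along coordinate fields. -/
theorem mvfderiv_mvfderiv_extend_comm [I.Boundaryless] {F : Type*} [NormedAddCommGroup F]
    [NormedSpace ℝ F] {f : N → F} {p : N} (hf : ContMDiffAt I 𝓘(ℝ, F) ∞ f p)
    (u v : TangentSpace I p) :
    mvfderiv I (fun q => mvfderiv I f q (extend E v q)) p u
      = mvfderiv I (fun q => mvfderiv I f q (extend E u q)) p v := by
  obtain ⟨B, hB, h⟩ := exists_symm_mvfderiv_mvfderiv_extend hf
  exact ((h v).2 u).trans ((hB u v).trans ((h u).2 v).symm)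

theorem mdifferentiableAt_mvfderiv_extend [I.Boundaryless] {F : Type*} [NormedAddCommGroup F]
    [NormedSpace ℝ F] {f : N → F} {p : N} (hf : ContMDiffAt I 𝓘(ℝ, F) ∞ f p)
    (v : TangentSpace I p) :
    MDifferentiableAt I 𝓘(ℝ, F) (fun q => mvfderiv I f q (extend E v q)) p := by
  obtain ⟨B, hB, h⟩ := exists_symm_mvfderiv_mvfderiv_extend hf
  exact (h v).1

end Charts

/-! ### `∇φ` on `ker η` for the three classes of structures. -/

section Structures

open Filter Topology

variable {E : Type*} [NormedAddCommGroup E] [NormedSpace ℝ E]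
  {H : Type*} [TopologicalSpace H] {I : ModelWithCorners ℝ E H}
  {N : Type*} [TopologicalSpace N] [ChartedSpace H N] [IsManifold I ∞ N]
  {cov : CovariantDerivative I E (TangentSpace I : N → Type _)}

namespace AlmostContactMetric

variable {S : AlmostContactMetric I N}

/-- For `η y = 0` the Kenmotsu formula leaves a multiple of `ξ`, which is orthogonal to `z`. -/
theorem IsKenmotsu.inner_covφ_eq_zero (hS : S.IsKenmotsu cov) (p : N) {x y z : TangentSpace I p}
    (hy : S.η p y = 0) (hz : S.η p z = 0) : S.g.inner p (S.covφ cov p x y) z = 0 := by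
  have h := hS p x _ (smoothFieldAt_extend y)
  rw [extend_apply_self, hy, zero_smul, sub_zero] at h
  rw [covφ, h, map_smul, smul_apply, S.g.symm p (S.ξ p), ← S.η_eq_inner, hz, smul_zero]

variable [FiniteDimensional ℝ E]

/-- Closedness of `η` makes `∇ξ` symmetric, so the condition on `dη` is trivial. Evaluated on
commuting coordinate fields, `dΦ = 0` is the vanishing of the cyclic sum of `∇φ`. -/
theorem IsCosymplectic.inner_covφ_eq_zero (hcov : IsLeviCivita S.g cov) (hS : S.IsCosymplectic)
    (p : N) {x y z : TangentSpace I p} (hy : S.η p y = 0) (hz : S.η p z = 0) :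
    S.g.inner p (S.covφ cov p x y) z = 0 := by
  have : CompleteSpace E := FiniteDimensional.complete ℝ E
  have hs := fun v : TangentSpace I p => smoothFieldAt_extend (I := I) v
  have hb := mlieBracket_extend (I := I) (mem_chart_source H p)
  have hd : ∀ v w : TangentSpace I p,
      S.g.inner p (cov S.ξ p v) w - S.g.inner p (cov S.ξ p w) v = 0 := by
    intro v w
    have h1 := two_mul_extDerivOne_η hcov (hs v) (hs w)
    rw [hS.1.closed_η p _ _ (hs v) (hs w)] at h1
    simpa using h1.symm
  refine hS.2.inner_covφ_eq_zero hcov p ?_ (fun y z _ _ => by rw [hd, hd]) hy hz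
  intro x y z
  have h1 := sum_mvfderiv_fundamentalForm hcov (hs x) (hs y) (hs z) (hb x y) (hb y z) (hb z x)
  have h2 := hS.1.closed_Φ p _ _ _ (hs x) (hs y) (hs z)
  have h0 : ∀ v : TangentSpace I p, S.fundamentalForm p 0 v = 0 := by simp [fundamentalForm]
  rw [extDerivTwo, hb, hb, hb, h0, h0, h0, h1] at h2
  simp only [extend_apply_self] at h2
  linarith

/-- Here `Φ = dη` is closed because `d² = 0`, which on coordinate fields is the symmetry of second
derivatives. The condition on `dη` holds because `g(φy, φz)` is symmetric in `y` and `z`. -/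
theorem IsSasakian.inner_covφ_eq_zero [I.Boundaryless] (hcov : IsLeviCivita S.g cov)
    (hS : S.IsSasakian) (p : N) {x y z : TangentSpace I p} (hy : S.η p y = 0)
    (hz : S.η p z = 0) : S.g.inner p (S.covφ cov p x y) z = 0 := by
  have : CompleteSpace E := FiniteDimensional.complete ℝ E
  have hs := fun v : TangentSpace I p => smoothFieldAt_extend (I := I) v
  have hb := mlieBracket_extend (I := I) (mem_chart_source H p)
  have hd : ∀ v w : TangentSpace I p,
      S.g.inner p (cov S.ξ p v) w - S.g.inner p (cov S.ξ p w) v = 2 * S.g.inner p v (S.φ p w) := by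
    intro v w
    have h1 := two_mul_extDerivOne_η hcov (hs v) (hs w)
    rw [← hS.1 p _ _ (hs v) (hs w)] at h1
    simpa [fundamentalForm] using h1.symm
  have hηs : ∀ v : TangentSpace I p,
      ContMDiffAt I 𝓘(ℝ) ∞ (fun q => S.η q (extend E v q)) p := by
    intro v
    simp only [S.η_eq_inner]
    exact contMDiffAt_inner S.g (hs v) (smoothFieldAt_ξ p)
  have hdiff : ∀ v w : TangentSpace I p, MDifferentiableAt I 𝓘(ℝ)
      (fun q => mvfderiv I (fun q => S.η q (extend E w q)) q (extend E v q)) p :=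
    fun v w => mdifferentiableAt_mvfderiv_extend (hηs w) v
  refine hS.2.inner_covφ_eq_zero hcov p ?_ (fun y z _ _ => by
    rw [hd, hd, S.inner_φ_left, S.inner_φ_left, S.inner_φ_φ_sq, S.inner_φ_φ_sq,
      S.g.symm p y z]; ring) hy hz
  intro x y z
  have h1 := sum_mvfderiv_fundamentalForm hcov (hs x) (hs y) (hs z) (hb x y) (hb y z) (hb z x)
  have key : ∀ u v w : TangentSpace I p,
      mvfderiv I (fun q => S.fundamentalForm q (extend E v q) (extend E w q)) p u
        = (1 / 2) * (mvfderiv I (fun q => mvfderiv I (fun q => S.η q (extend E w q)) q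
            (extend E v q)) p u - mvfderiv I (fun q => mvfderiv I (fun q => S.η q (extend E v q)) q
            (extend E w q)) p u) := by
    intro u v w
    -- The contact condition is to be differentiated, so it is needed near `p`: on the whole chart
    -- domain the coordinate fields are smooth and commute.
    have heq : (fun q => S.fundamentalForm q (extend E v q) (extend E w q)) =ᶠ[𝓝 p]
        (fun _ : N => (1 / 2 : ℝ)) *
          ((fun q => mvfderiv I (fun q => S.η q (extend E w q)) q (extend E v q))
          - (fun q => mvfderiv I (fun q => S.η q (extend E v q)) q (extend E w q))) := by
      filter_upwards [eventually_mem_chart_source (H := H) p] with q hq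
      rw [hS.1 q _ _ (smoothFieldAt_extend_of_mem hq v) (smoothFieldAt_extend_of_mem hq w),
        extDerivOne, mlieBracket_extend hq, map_zero, sub_zero]
      rfl
    have hmv : mvfderiv I (fun q => S.fundamentalForm q (extend E v q) (extend E w q)) p
        = mvfderiv I ((fun _ : N => (1 / 2 : ℝ)) *
          ((fun q => mvfderiv I (fun q => S.η q (extend E w q)) q (extend E v q))
          - (fun q => mvfderiv I (fun q => S.η q (extend E v q)) q (extend E w q)))) p :=
      heq.mfderiv_eq
    rw [hmv, mvfderiv_mul mdifferentiableAt_const ((hdiff v w).sub (hdiff w v)),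
      mvfderiv_sub (hdiff v w) (hdiff w v), mvfderiv_const]
    simp
  simp only [extend_apply_self] at h1
  rw [key, key, key] at h1
  have c1 := mvfderiv_mvfderiv_extend_comm (hηs z) x y
  have c2 := mvfderiv_mvfderiv_extend_comm (hηs x) y z
  have c3 := mvfderiv_mvfderiv_extend_comm (hηs y) z x
  linarith

end AlmostContactMetric

end Structures

/-! ### The pulled back connection on fields along `ι`. -/

section Along

open Filter Topology

variable {E' : Type*} [NormedAddCommGroup E'] [NormedSpace ℝ E']
  {H' : Type*} [TopologicalSpace H'] {J : ModelWithCorners ℝ E' H'}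
  {M : Type*} [TopologicalSpace M] [ChartedSpace H' M]
  {E : Type*} [NormedAddCommGroup E] [NormedSpace ℝ E]
  {H : Type*} [TopologicalSpace H] {I : ModelWithCorners ℝ E H}
  {N : Type*} [TopologicalSpace N] [ChartedSpace H N] [IsManifold I ∞ N]
  {cov : CovariantDerivative I E (TangentSpace I : N → Type _)} {ι : M → N} {p : M}

theorem eventually_extend_add (x : N) (v w : TangentSpace I x) :
    (extend E (v + w) : VField I N) =ᶠ[𝓝 x] extend E v + extend E w := by
  filter_upwards [eventually_mem_chart_source (H := H) x] with y hy
  set t := trivializationAt E (TangentSpace I : N → Type _) x with ht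
  have hy' : y ∈ t.baseSet := hy
  have hx' : x ∈ t.baseSet := mem_chart_source H x
  simp only [extend, Pi.add_apply, ← ht]
  rw [← t.symmL_apply (R := ℝ) hy', ← t.symmL_apply (R := ℝ) hy',
    ← t.symmL_apply (R := ℝ) hy', ← map_add,
    ← t.continuousLinearMapAt_apply_of_mem ℝ hx', ← t.continuousLinearMapAt_apply_of_mem ℝ hx',
    ← t.continuousLinearMapAt_apply_of_mem ℝ hx', map_add]

theorem eventually_extend_smul (x : N) (c : ℝ) (v : TangentSpace I x) :
    (extend E (c • v) : VField I N) =ᶠ[𝓝 x] c • extend E v := by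
  filter_upwards [eventually_mem_chart_source (H := H) x] with y hy
  set t := trivializationAt E (TangentSpace I : N → Type _) x with ht
  have hy' : y ∈ t.baseSet := hy
  have hx' : x ∈ t.baseSet := mem_chart_source H x
  simp only [extend, Pi.smul_apply, ← ht]
  rw [← t.symmL_apply (R := ℝ) hy', ← t.symmL_apply (R := ℝ) hy', ← map_smul,
    ← t.continuousLinearMapAt_apply_of_mem ℝ hx', ← t.continuousLinearMapAt_apply_of_mem ℝ hx',
    map_smul]

/-- `extend` is linear in the vector only near the base point, which suffices because a connection
is local. -/
theorem cov_extend_add (x : N) (v w : TangentSpace I x) :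
    cov (extend E (v + w)) x = cov (extend E v) x + cov (extend E w) x := by
  rw [← cov.isCovariantDerivativeOn.add (diffFieldAt_extend v) (diffFieldAt_extend w)]
  exact cov.isCovariantDerivativeOn.congr_of_eventuallyEq (s := Set.univ) (diffFieldAt_extend _)
    (mdifferentiableAt_add_section (diffFieldAt_extend v) (diffFieldAt_extend w)) univ_mem
    (eventually_extend_add x v w)

theorem cov_extend_smul (x : N) (c : ℝ) (v : TangentSpace I x) :
    cov (extend E (c • v)) x = c • cov (extend E v) x := by
  rw [← cov.isCovariantDerivativeOn.smul_const c (diffFieldAt_extend v)]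
  exact cov.isCovariantDerivativeOn.congr_of_eventuallyEq (s := Set.univ) (diffFieldAt_extend _)
    (MDifferentiableAt.smul_const_section (diffFieldAt_extend v)) univ_mem
    (eventually_extend_smul x c v)

variable (J) in
/-- Differentiability at `p` of a vector field along `ι`. -/
def DiffAlong (ι : M → N) (W : (q : M) → TangentSpace I (ι q)) (p : M) : Prop :=
  MDifferentiableAt J I.tangent (fun q => (⟨ι q, W q⟩ : TangentBundle I N)) p

/-- The coordinates of a vector field along `ι` in the trivialization at `ι p`. -/
def coordAlong (ι : M → N) (W : (q : M) → TangentSpace I (ι q)) (p q : M) : E :=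
  (trivializationAt E (TangentSpace I : N → Type _) (ι p) (⟨ι q, W q⟩ : TangentBundle I N)).2

theorem diffAlong_iff {W : (q : M) → TangentSpace I (ι q)} :
    DiffAlong J ι W p ↔
      MDifferentiableAt J I ι p ∧ MDifferentiableAt J 𝓘(ℝ, E) (coordAlong ι W p) p :=
  mdifferentiableAt_totalSpace ..

theorem covAlong_eq (W : (q : M) → TangentSpace I (ι q)) (u : TangentSpace J p) :
    covAlong cov ι W p u
      = (trivializationAt E (TangentSpace I : N → Type _) (ι p)).symmL ℝ (ι p)
          (mvfderiv J (coordAlong ι W p) p u)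
        + cov (extend E (W p)) (ι p) (mfderiv J I ι p u) := by
  rw [Trivialization.symmL_apply (R := ℝ) _ (mem_chart_source H (ι p))]
  rfl

theorem eventually_coordAlong_add (hι : ContinuousAt ι p) (W W' : (q : M) → TangentSpace I (ι q)) :
    coordAlong ι (W + W') p =ᶠ[𝓝 p] coordAlong ι W p + coordAlong ι W' p := by
  filter_upwards [hι.eventually (eventually_mem_chart_source (H := H) (ι p))] with q hq
  set t := trivializationAt E (TangentSpace I : N → Type _) (ι p) with ht
  have hq' : ι q ∈ t.baseSet := hq
  simp only [coordAlong, Pi.add_apply, ← ht]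
  rw [← t.continuousLinearMapAt_apply_of_mem ℝ hq', ← t.continuousLinearMapAt_apply_of_mem ℝ hq',
    ← t.continuousLinearMapAt_apply_of_mem ℝ hq', map_add]

theorem eventually_coordAlong_smul (hι : ContinuousAt ι p) (f : M → ℝ)
    (W : (q : M) → TangentSpace I (ι q)) :
    coordAlong ι (f • W) p =ᶠ[𝓝 p] f • coordAlong ι W p := by
  filter_upwards [hι.eventually (eventually_mem_chart_source (H := H) (ι p))] with q hq
  set t := trivializationAt E (TangentSpace I : N → Type _) (ι p) with ht
  have hq' : ι q ∈ t.baseSet := hq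
  simp only [coordAlong, Pi.smul_apply', ← ht]
  rw [← t.continuousLinearMapAt_apply_of_mem ℝ hq', ← t.continuousLinearMapAt_apply_of_mem ℝ hq',
    map_smul]

namespace DiffAlong

variable {W W' : (q : M) → TangentSpace I (ι q)}

theorem base (h : DiffAlong J ι W p) : MDifferentiableAt J I ι p := (diffAlong_iff.1 h).1

theorem coord (h : DiffAlong J ι W p) : MDifferentiableAt J 𝓘(ℝ, E) (coordAlong ι W p) p :=
  (diffAlong_iff.1 h).2

theorem add (h : DiffAlong J ι W p) (h' : DiffAlong J ι W' p) : DiffAlong J ι (W + W') p :=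
  diffAlong_iff.2 ⟨h.base, (h.coord.add h'.coord).congr_of_eventuallyEq
    (eventually_coordAlong_add h.base.continuousAt W W')⟩

theorem smul {f : M → ℝ} (hf : MDifferentiableAt J 𝓘(ℝ) f p) (h : DiffAlong J ι W p) :
    DiffAlong J ι (f • W) p :=
  diffAlong_iff.2 ⟨h.base, (hf.smul h.coord).congr_of_eventuallyEq
    (eventually_coordAlong_smul h.base.continuousAt f W)⟩

theorem neg (h : DiffAlong J ι W p) : DiffAlong J ι (-W) p := by
  have := smul (f := fun _ => (-1 : ℝ)) mdifferentiableAt_const h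
  convert this using 1
  ext q; simp

theorem sub (h : DiffAlong J ι W p) (h' : DiffAlong J ι W' p) : DiffAlong J ι (W - W') p := by
  rw [sub_eq_add_neg]; exact h.add h'.neg

theorem comp {Z : VField I N} (hZ : DiffFieldAt Z (ι p)) (hι : MDifferentiableAt J I ι p) :
    DiffAlong J ι (fun q => Z (ι q)) p :=
  MDifferentiableAt.comp p hZ hι

theorem φ (S : AlmostContactMetric I N) (h : DiffAlong J ι W p) :
    DiffAlong J ι (fun q => S.φ (ι q) (W q)) p :=
  MDifferentiableAt.clm_bundle_apply (b := ι)
    (((S.smooth_φ (ι p)).mdifferentiableAt (by simp)).comp p h.base) h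

theorem inner (g : MetricTensor I N) (h : DiffAlong J ι W p) (h' : DiffAlong J ι W' p) :
    MDifferentiableAt J 𝓘(ℝ) (fun q => g.inner (ι q) (W q) (W' q)) p := by
  have := MDifferentiableAt.clm_bundle_apply₂ (b := ι) (F₁ := E) (F₂ := E) (F₃ := ℝ)
    (E₃ := fun _ : N => ℝ) (((g.contMDiff (ι p)).mdifferentiableAt (by simp)).comp p h.base) h h'
  exact ((mdifferentiableAt_totalSpace ..).1 this).2

end DiffAlong

section covAlong

variable {W W' : (q : M) → TangentSpace I (ι q)}

theorem covAlong_add (h : DiffAlong J ι W p) (h' : DiffAlong J ι W' p) (u : TangentSpace J p) :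
    covAlong cov ι (W + W') p u = covAlong cov ι W p u + covAlong cov ι W' p u := by
  have h1 : mvfderiv J (coordAlong ι (W + W') p) p
      = mvfderiv J (coordAlong ι W p + coordAlong ι W' p) p :=
    (eventually_coordAlong_add h.base.continuousAt W W').mfderiv_eq
  simp only [covAlong_eq, Pi.add_apply]
  rw [h1, mvfderiv_add h.coord h'.coord, cov_extend_add]
  simp only [add_apply, map_add]
  abel

theorem covAlong_smul {f : M → ℝ} (hf : MDifferentiableAt J 𝓘(ℝ) f p) (h : DiffAlong J ι W p)
    (u : TangentSpace J p) :
    covAlong cov ι (f • W) p u = f p • covAlong cov ι W p u + mvfderiv J f p u • W p := by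
  have h1 : mvfderiv J (coordAlong ι (f • W) p) p = mvfderiv J (f • coordAlong ι W p) p :=
    (eventually_coordAlong_smul h.base.continuousAt f W).mfderiv_eq
  have h2 : (trivializationAt E (TangentSpace I : N → Type _) (ι p)).symmL ℝ (ι p)
      (coordAlong ι W p p) = W p := by
    rw [Trivialization.symmL_apply (R := ℝ) _ (mem_chart_source H (ι p))]
    exact Trivialization.symm_apply_apply_mk _ (mem_chart_source H (ι p)) (W p)
  simp only [covAlong_eq, Pi.smul_apply']
  rw [h1, mvfderiv_smul hf h.coord, cov_extend_smul]
  simp only [add_apply, map_add, smul_apply, ContinuousLinearMap.smulRight_apply, map_smul, h2,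
    smul_add]
  abel

theorem covAlong_neg (h : DiffAlong J ι W p) (u : TangentSpace J p) :
    covAlong cov ι (-W) p u = -covAlong cov ι W p u := by
  have h1 : -W = (fun _ : M => (-1 : ℝ)) • W := by ext q; simp
  rw [h1, covAlong_smul mdifferentiableAt_const h, mvfderiv_const]
  simp

theorem covAlong_sub (h : DiffAlong J ι W p) (h' : DiffAlong J ι W' p) (u : TangentSpace J p) :
    covAlong cov ι (W - W') p u = covAlong cov ι W p u - covAlong cov ι W' p u := by
  rw [sub_eq_add_neg, covAlong_add h h'.neg, covAlong_neg h', sub_eq_add_neg]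

theorem covAlong_zero_right (W : (q : M) → TangentSpace I (ι q)) :
    covAlong cov ι W p (0 : TangentSpace J p) = 0 := by
  simp [covAlong_eq]

/-- A covariant derivative is the derivative of the coordinates plus a tensorial term. -/
theorem cov_eq_symmL_add [FiniteDimensional ℝ E] {Z : VField I N} {x : N} (hZ : DiffFieldAt Z x)
    (v : TangentSpace I x) :
    cov Z x v = (trivializationAt E (TangentSpace I : N → Type _) x).symmL ℝ x
        (mvfderiv I (coordAlong (fun y : N => y) Z x) x v)
      + cov (extend E (Z x)) x v := by
  have hid : ContinuousAt (fun y : N => y) x := continuousAt_id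
  have ht : TensorialAt I E (fun Z : VField I N => cov Z x v -
      (trivializationAt E (TangentSpace I : N → Type _) x).symmL ℝ x
        (mvfderiv I (coordAlong (fun y : N => y) Z x) x v)) x := by
    constructor
    · intro f Z hf hZ
      have hZ' : DiffAlong I (fun y : N => y) Z x := hZ
      have h1 : mvfderiv I (coordAlong (fun y : N => y) (f • Z) x) x
          = mvfderiv I (f • coordAlong (fun y : N => y) Z x) x :=
        (eventually_coordAlong_smul hid f Z).mfderiv_eq
      have h2 : (trivializationAt E (TangentSpace I : N → Type _) x).symmL ℝ x
          (coordAlong (fun y : N => y) Z x x) = Z x := by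
        rw [Trivialization.symmL_apply (R := ℝ) _ (mem_chart_source H x)]
        exact Trivialization.symm_apply_apply_mk _ (mem_chart_source H x) (Z x)
      rw [h1, mvfderiv_smul hf hZ'.coord, cov.isCovariantDerivativeOn.leibniz hZ hf]
      simp only [add_apply, map_add, smul_apply, ContinuousLinearMap.smulRight_apply, map_smul,
        h2, smul_sub]
      abel
    · intro Z Z' hZ hZ'
      have hd : DiffAlong I (fun y : N => y) Z x := hZ
      have hd' : DiffAlong I (fun y : N => y) Z' x := hZ'
      have h1 : mvfderiv I (coordAlong (fun y : N => y) (Z + Z') x) x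
          = mvfderiv I (coordAlong (fun y : N => y) Z x + coordAlong (fun y : N => y) Z' x) x :=
        (eventually_coordAlong_add hid Z Z').mfderiv_eq
      rw [h1, mvfderiv_add hd.coord hd'.coord, cov.isCovariantDerivativeOn.add hZ hZ']
      simp only [add_apply, map_add]
      abel
  have h := ht.pointwise hZ (diffFieldAt_extend (Z x)) (by simp)
  -- The coordinates of `extend` are constant, so only the tensorial term survives for it.
  have h0 : mvfderiv I (coordAlong (fun y : N => y) (extend E (Z x)) x) x = 0 := by
    have heq : coordAlong (fun y : N => y) (extend E (Z x)) x =ᶠ[𝓝 x] fun _ =>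
        (trivializationAt E (TangentSpace I : N → Type _) x (⟨x, Z x⟩ : TangentBundle I N)).2 := by
      filter_upwards [eventually_mem_chart_source (H := H) x] with y hy
      exact trivializationAt_extend hy (Z x)
    have h1 : mvfderiv I (coordAlong (fun y : N => y) (extend E (Z x)) x) x
        = mvfderiv I (fun _ : N => (trivializationAt E (TangentSpace I : N → Type _) x
          (⟨x, Z x⟩ : TangentBundle I N)).2) x := heq.mfderiv_eq
    rw [h1, mvfderiv_const]
  simp only [h0, zero_apply, map_zero, sub_zero] at h
  rw [← h]
  abel

/-- The chain rule for the coordinates. It ties the coordinate formula of `covAlong` to the ambient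
connection. -/
theorem covAlong_comp [FiniteDimensional ℝ E] {Z : VField I N} (hZ : DiffFieldAt Z (ι p))
    (hι : MDifferentiableAt J I ι p) (u : TangentSpace J p) :
    covAlong cov ι (fun q => Z (ι q)) p u = cov Z (ι p) (mfderiv J I ι p u) := by
  have hZ' : DiffAlong I (fun y : N => y) Z (ι p) := hZ
  rw [covAlong_eq, cov_eq_symmL_add hZ]
  have h1 : coordAlong ι (fun q => Z (ι q)) p = coordAlong (fun y : N => y) Z (ι p) ∘ ι := rfl
  have h2 : mvfderiv J (coordAlong ι (fun q => Z (ι q)) p) p u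
      = mvfderiv I (coordAlong (fun y : N => y) Z (ι p)) (ι p) (mfderiv J I ι p u) := by
    rw [h1]
    exact mfderiv_comp_apply p hZ'.coord hι u
  rw [h2]

/-- An operation on fields along `ι` that is additive and linear over functions vanishes as soon
as it vanishes on restrictions of fields of the ambient manifold. -/
theorem DiffAlong.eq_zero_of_tensorial [FiniteDimensional ℝ E] {A : Type*} [AddCommGroup A]
    [Module ℝ A] {Ψ : ((q : M) → TangentSpace I (ι q)) → A}
    (hadd : ∀ W W', DiffAlong J ι W p → DiffAlong J ι W' p → Ψ (W + W') = Ψ W + Ψ W')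
    (hsmul : ∀ (f : M → ℝ) W, MDifferentiableAt J 𝓘(ℝ) f p → DiffAlong J ι W p →
      Ψ (f • W) = f p • Ψ W)
    (hcomp : ∀ Z : VField I N, SmoothFieldAt Z (ι p) → Ψ (fun q => Z (ι q)) = 0)
    (hW : DiffAlong J ι W p) : Ψ W = 0 := by
  classical
  -- Locality without bump functions: the indicator of the set where the two fields agree is
  -- differentiable at `p`, being constant near it, and no regularity elsewhere is required.
  have hlocal : ∀ W W' : (q : M) → TangentSpace I (ι q), DiffAlong J ι W p → DiffAlong J ι W' p →
      (∀ᶠ q in 𝓝 p, W q = W' q) → Ψ W = Ψ W' := by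
    intro W W' hW hW' h
    let ψ (q : M) : ℝ := if W q = W' q then 1 else 0
    have hψp : ψ p = 1 := by simp [ψ, h.self_of_nhds]
    have heq : ψ • W = ψ • W' := by
      ext q
      simp only [Pi.smul_apply', ψ]
      split_ifs with hq <;> simp [hq]
    have hψ : MDifferentiableAt J 𝓘(ℝ) ψ p :=
      (mdifferentiableAt_const (c := (1 : ℝ))).congr_of_eventuallyEq
        (h.mono fun q hq => by simp [ψ, hq])
    have h1 := hsmul ψ W hψ hW
    have h2 := hsmul ψ W' hψ hW'
    rw [hψp, one_smul] at h1 h2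
    rw [← h1, ← h2, heq]
  set t := trivializationAt E (TangentSpace I : N → Type _) (ι p) with ht
  let b := Module.finBasis ℝ E
  let a (i) (q : M) : ℝ := b.equivFun (coordAlong ι W p q) i
  let e (i) : VField I N := extend (x := ι p) E (t.symm (ι p) (b i))
  have ha : ∀ i, MDifferentiableAt J 𝓘(ℝ) (a i) p := by
    intro i
    let L : E →L[ℝ] ℝ := LinearMap.toContinuousLinearMap (b.coord i)
    have hL : MDifferentiableAt 𝓘(ℝ, E) 𝓘(ℝ) L (coordAlong ι W p p) :=
      L.differentiableAt.mdifferentiableAt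
    exact hL.comp p hW.coord
  have he : ∀ i, SmoothFieldAt (e i) (ι p) := fun i => smoothFieldAt_extend _
  have hed : ∀ i, DiffAlong J ι (fun q => e i (ι q)) p := fun i =>
    DiffAlong.comp (he i).diffFieldAt hW.base
  have hterm : ∀ i, DiffAlong J ι (a i • fun q => e i (ι q)) p := fun i =>
    DiffAlong.smul (ha i) (hed i)
  have hsum : ∀ s : Finset (Fin (Module.finrank ℝ E)),
      DiffAlong J ι (∑ i ∈ s, a i • fun q => e i (ι q)) p ∧
      Ψ (∑ i ∈ s, a i • fun q => e i (ι q)) = 0 := by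
    intro s
    induction s using Finset.induction_on with
    | empty =>
      -- The zero field is `0 • W`, which yields both its differentiability and `Ψ 0 = 0`.
      have h0 : ((0 : M → ℝ) • W) = 0 := by ext q; simp
      have hc : MDifferentiableAt J 𝓘(ℝ) (0 : M → ℝ) p := mdifferentiableAt_const
      have h1 := hsmul 0 W hc hW
      have h2 := DiffAlong.smul hc hW
      rw [h0] at h1 h2
      simpa using And.intro h2 h1
    | insert i s hi ih =>
      rw [Finset.sum_insert hi]
      refine ⟨(hterm i).add ih.1, ?_⟩
      rw [hadd _ _ (hterm i) ih.1, hsmul _ _ (ha i) (hed i), hcomp _ (he i), ih.2]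
      simp
  rw [hlocal W _ hW (hsum Finset.univ).1, (hsum Finset.univ).2]
  filter_upwards [hW.base.continuousAt.eventually
    (eventually_mem_chart_source (H := H) (ι p))] with q hq
  have hq' : ι q ∈ t.baseSet := hq
  have hp' : ι p ∈ t.baseSet := mem_chart_source H (ι p)
  have h1 : ∀ i, e i (ι q) = t.symmL ℝ (ι q) (b i) := by
    intro i
    simp only [e, extend, ← ht]
    rw [t.apply_mk_symm hp', t.symmL_apply (R := ℝ) hq']
  simp only [Finset.sum_apply, Pi.smul_apply', h1, ← map_smul, ← map_sum]
  have h2 : ∑ i, a i q • b i = coordAlong ι W p q := b.sum_equivFun _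
  rw [h2, t.symmL_apply (R := ℝ) hq']
  exact (t.symm_apply_apply_mk hq' (W q)).symm

end covAlong

end Along

/-! ### Product rules for `g` and `φ` along `ι`. -/

section AlongMetric

open Filter Topology

variable {E' : Type*} [NormedAddCommGroup E'] [NormedSpace ℝ E']
  {H' : Type*} [TopologicalSpace H'] {J : ModelWithCorners ℝ E' H'}
  {M : Type*} [TopologicalSpace M] [ChartedSpace H' M]
  {E : Type*} [NormedAddCommGroup E] [NormedSpace ℝ E] [FiniteDimensional ℝ E]
  {H : Type*} [TopologicalSpace H] {I : ModelWithCorners ℝ E H}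
  {N : Type*} [TopologicalSpace N] [ChartedSpace H N] [IsManifold I ∞ N]
  {cov : CovariantDerivative I E (TangentSpace I : N → Type _)} {ι : M → N} {p : M}
  {W W' : (q : M) → TangentSpace I (ι q)}

/-- The pulled back Levi-Civita connection is metric. -/
theorem mvfderiv_inner_along {g : MetricTensor I N} (hcov : IsLeviCivita g cov)
    (hW : DiffAlong J ι W p) (hW' : DiffAlong J ι W' p) (u : TangentSpace J p) :
    mvfderiv J (fun q => g.inner (ι q) (W q) (W' q)) p u
      = g.inner (ι p) (covAlong cov ι W p u) (W' p)
        + g.inner (ι p) (W p) (covAlong cov ι W' p u) := by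
  have hι := hW.base
  -- Reduction of one slot to ambient fields. It is used for the first slot and then, by symmetry of
  -- `g`, for the second; what remains is the metric property on `N`.
  have step : ∀ (V : (q : M) → TangentSpace I (ι q)), DiffAlong J ι V p →
      (∀ Z : VField I N, SmoothFieldAt Z (ι p) →
        mvfderiv J (fun q => g.inner (ι q) (Z (ι q)) (V q)) p u
        - (g.inner (ι p) (covAlong cov ι (fun q => Z (ι q)) p u) (V p)
          + g.inner (ι p) (Z (ι p)) (covAlong cov ι V p u)) = 0) →
      ∀ W, DiffAlong J ι W p → mvfderiv J (fun q => g.inner (ι q) (W q) (V q)) p u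
        - (g.inner (ι p) (covAlong cov ι W p u) (V p)
          + g.inner (ι p) (W p) (covAlong cov ι V p u)) = 0 := by
    intro V hV hZ W hW
    refine DiffAlong.eq_zero_of_tensorial (J := J) (Ψ := fun W =>
      mvfderiv J (fun q => g.inner (ι q) (W q) (V q)) p u
        - (g.inner (ι p) (covAlong cov ι W p u) (V p)
          + g.inner (ι p) (W p) (covAlong cov ι V p u))) ?_ ?_ hZ hW
    · intro W W' h h'
      have h1 : (fun q => g.inner (ι q) ((W + W') q) (V q))
          = (fun q => g.inner (ι q) (W q) (V q)) + (fun q => g.inner (ι q) (W' q) (V q)) := by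
        ext q; simp
      rw [h1, mvfderiv_add (h.inner g hV) (h'.inner g hV), covAlong_add h h']
      simp only [map_add, add_apply, Pi.add_apply]
      ring
    · intro f W hf h
      have h1 : (fun q => g.inner (ι q) ((f • W) q) (V q))
          = f * (fun q => g.inner (ι q) (W q) (V q)) := by
        ext q; simp
      rw [h1, mvfderiv_mul hf (h.inner g hV), covAlong_smul hf h]
      simp only [map_add, map_smul, add_apply, smul_apply, Pi.smul_apply', smul_eq_mul]
      ring
  refine sub_eq_zero.1 (step W' hW' ?_ W hW)
  intro Z hZ
  have hZι : DiffAlong J ι (fun q => Z (ι q)) p := DiffAlong.comp hZ.diffFieldAt hι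
  have hsymm : ∀ V : (q : M) → TangentSpace I (ι q),
      mvfderiv J (fun q => g.inner (ι q) (Z (ι q)) (V q)) p u
        - (g.inner (ι p) (covAlong cov ι (fun q => Z (ι q)) p u) (V p)
          + g.inner (ι p) (Z (ι p)) (covAlong cov ι V p u))
      = mvfderiv J (fun q => g.inner (ι q) (V q) (Z (ι q))) p u
        - (g.inner (ι p) (covAlong cov ι V p u) (Z (ι p))
          + g.inner (ι p) (V p) (covAlong cov ι (fun q => Z (ι q)) p u)) := by
    intro V
    simp only [g.symm _ (V _) _]
    rw [g.symm _ (covAlong cov ι V p u)]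
    ring
  rw [hsymm]
  refine step (fun q => Z (ι q)) hZι ?_ W' hW'
  intro Y hY
  rw [covAlong_comp hZ.diffFieldAt hι, covAlong_comp hY.diffFieldAt hι, sub_eq_zero,
    ← hcov.metric _ _ _ hY hZ]
  exact mfderiv_comp_apply p (mdifferentiableAt_inner g hY hZ) hι u

/-- The field `extend (w + w')` need not be the sum of the extensions globally; tensoriality allows
comparing them at `x` alone. -/
theorem AlmostContactMetric.covφ_add_right (S : AlmostContactMetric I N) (x : N)
    (v w w' : TangentSpace I x) :
    S.covφ cov x v (w + w') = S.covφ cov x v w + S.covφ cov x v w' := by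
  have h := (S.tensorialAt_cov_φField (cov := cov) x v)
  have h1 := h.add (diffFieldAt_extend w) (diffFieldAt_extend w')
  rw [covφ, covφ, covφ, ← h1]
  exact h.pointwise (diffFieldAt_extend _)
    (mdifferentiableAt_add_section (diffFieldAt_extend w) (diffFieldAt_extend w')) (by simp)

theorem AlmostContactMetric.covφ_smul_right (S : AlmostContactMetric I N) (x : N) (c : ℝ)
    (v w : TangentSpace I x) : S.covφ cov x v (c • w) = c • S.covφ cov x v w := by
  have h := (S.tensorialAt_cov_φField (cov := cov) x v)
  have hc : MDifferentiableAt I 𝓘(ℝ) (fun _ : N => c) x := mdifferentiableAt_const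
  have h1 := h.smul hc (diffFieldAt_extend w)
  rw [covφ, covφ, ← h1]
  exact h.pointwise (diffFieldAt_extend _) (hc.smul_section (diffFieldAt_extend w)) (by simp)

/-- The difference of the two sides is linear over functions in `W`, and it vanishes on ambient
fields by the definition of `∇φ`. -/
theorem covAlong_φ (S : AlmostContactMetric I N) (hW : DiffAlong J ι W p) (u : TangentSpace J p) :
    covAlong cov ι (fun q => S.φ (ι q) (W q)) p u
      = S.covφ cov (ι p) (mfderiv J I ι p u) (W p) + S.φ (ι p) (covAlong cov ι W p u) := by
  refine sub_eq_zero.1 (DiffAlong.eq_zero_of_tensorial (J := J) (Ψ := fun W =>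
    covAlong cov ι (fun q => S.φ (ι q) (W q)) p u
      - (S.covφ cov (ι p) (mfderiv J I ι p u) (W p) + S.φ (ι p) (covAlong cov ι W p u)))
    ?_ ?_ ?_ hW)
  · intro W W' h h'
    have h1 : (fun q => S.φ (ι q) ((W + W') q))
        = (fun q => S.φ (ι q) (W q)) + (fun q => S.φ (ι q) (W' q)) := by
      ext q; simp
    rw [h1, covAlong_add (h.φ S) (h'.φ S), covAlong_add h h', Pi.add_apply, S.covφ_add_right,
      map_add]
    abel
  · intro f W hf h
    have h1 : (fun q => S.φ (ι q) ((f • W) q)) = f • (fun q => S.φ (ι q) (W q)) := by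
      ext q; simp
    rw [h1, covAlong_smul hf (h.φ S), covAlong_smul hf h, Pi.smul_apply', S.covφ_smul_right,
      map_add, map_smul, map_smul, smul_sub, smul_add]
    abel
  · intro Z hZ
    have h1 := covAlong_comp (cov := cov) (AlmostContactMetric.diffFieldAt_φField (S := S)
      hZ.diffFieldAt) hW.base u
    rw [AlmostContactMetric.cov_φField hZ.diffFieldAt,
      ← covAlong_comp hZ.diffFieldAt hW.base] at h1
    exact sub_eq_zero.2 h1

end AlongMetric

/-! ### Symmetry of the second fundamental form. -/

section TangentFields

open Filter Topology

variable {E' : Type*} [NormedAddCommGroup E'] [NormedSpace ℝ E']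
  {H' : Type*} [TopologicalSpace H'] {J : ModelWithCorners ℝ E' H'}
  {M : Type*} [TopologicalSpace M] [ChartedSpace H' M] [IsManifold J ∞ M]
  {E : Type*} [NormedAddCommGroup E] [NormedSpace ℝ E]
  {H : Type*} [TopologicalSpace H] {I : ModelWithCorners ℝ E H}
  {N : Type*} [TopologicalSpace N] [ChartedSpace H N] [IsManifold I ∞ N]
  {cov : CovariantDerivative I E (TangentSpace I : N → Type _)} {ι : M → N} {p : M}

theorem DiffFieldAt.mfderiv_along {V : VField J M} (hι : ContMDiff J I ∞ ι)
    (hV : DiffFieldAt V p) : DiffAlong J ι (fun q => mfderiv J I ι q (V q)) p := by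
  have h1 : ContMDiff J.tangent I.tangent 1 (tangentMap J I ι) :=
    hι.contMDiff_tangentMap (by rw [one_add_one_eq_two]; exact two_le_infty)
  exact (h1.mdifferentiableAt (by simp)).comp p hV

/-- The second fundamental form is symmetric. -/
theorem covAlong_mfderiv_extend_comm [FiniteDimensional ℝ E] [J.Boundaryless]
    {g : MetricTensor I N} (hcov : IsLeviCivita g cov) (hι : ContMDiff J I ∞ ι)
    (u v : TangentSpace J p) :
    covAlong cov ι (fun q => mfderiv J I ι q (extend E' v q)) p u
      = covAlong cov ι (fun q => mfderiv J I ι q (extend E' u q)) p v := by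
  have : CompleteSpace E := FiniteDimensional.complete ℝ E
  set c := extChartAt I (ι p) with hc
  have hf : ContMDiffAt J 𝓘(ℝ, E) ∞ (c ∘ ι) p :=
    ContMDiffAt.comp p (contMDiffAt_extChartAt (n := ∞)) (hι p)
  -- The coordinate part of the derivative is a second derivative of `c ∘ ι` along coordinate fields
  -- of `M`, hence symmetric.
  have hcoord : ∀ w : TangentSpace J p, mvfderiv J
      (coordAlong ι (fun q => mfderiv J I ι q (extend E' w q)) p) p
      = mvfderiv J (fun q => mvfderiv J (c ∘ ι) q (extend E' w q)) p := by
    intro w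
    have heq : coordAlong ι (fun q => mfderiv J I ι q (extend E' w q)) p
        =ᶠ[𝓝 p] fun q => mvfderiv J (c ∘ ι) q (extend E' w q) := by
      filter_upwards [(hι p).continuousAt.eventually
        (eventually_mem_chart_source (H := H) (ι p))] with q hq
      rw [coordAlong, trivializationAt_snd_eq_mfderiv hq]
      exact (mfderiv_comp_apply q (mdifferentiableAt_extChartAt hq)
        (hι.mdifferentiableAt (by simp)) (extend E' w q)).symm
    exact heq.mfderiv_eq
  -- The connection part is symmetric as well: torsion vanishes and coordinate fields of `N`
  -- commute.
  have hcomm := hcov.lieBracket_eq (diffFieldAt_extend (mfderiv J I ι p v))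
    (diffFieldAt_extend (mfderiv J I ι p u))
  rw [mlieBracket_extend (mem_chart_source H (ι p))] at hcomm
  simp only [extend_apply_self] at hcomm
  rw [covAlong_eq, covAlong_eq, hcoord, hcoord, mvfderiv_mvfderiv_extend_comm hf u v]
  simp only [extend_apply_self]
  rw [sub_eq_zero.1 hcomm.symm]

end TangentFields

/-! ### Positive definite forms and differentiability of operator families. -/

section LinearAlgebra

variable {V : Type*} [NormedAddCommGroup V] [NormedSpace ℝ V] [FiniteDimensional ℝ V]

/-- A positive definite form on a finite dimensional space identifies it with its dual. -/
theorem isInvertible_of_posDef {K : V →L[ℝ] V →L[ℝ] ℝ} (hK : ∀ v, v ≠ 0 → 0 < K v v) :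
    K.IsInvertible := by
  have hinj : Function.Injective K := by
    refine (injective_iff_map_eq_zero K).2 fun v hv => ?_
    by_contra h0
    have := hK v h0
    rw [hv] at this
    simp at this
  have hrank : Module.finrank ℝ V = Module.finrank ℝ (V →L[ℝ] ℝ) := by
    rw [← LinearEquiv.finrank_eq (LinearMap.toContinuousLinearMap (𝕜 := ℝ) (E := V) (F' := ℝ))]
    exact (Subspace.dual_finrank_eq (K := ℝ) (V := V)).symm
  let e : V ≃ₗ[ℝ] (V →L[ℝ] ℝ) :=
    LinearEquiv.ofInjectiveOfFinrankEq (K : V →ₗ[ℝ] (V →L[ℝ] ℝ)) hinj hrank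
  refine ⟨e.toContinuousLinearEquiv, ?_⟩
  ext v w
  rfl

/-- A family of continuous linear maps on a finite dimensional space is differentiable as soon as
its values are. -/
theorem mdifferentiableAt_clm_of_apply {E' : Type*} [NormedAddCommGroup E'] [NormedSpace ℝ E']
    {H' : Type*} [TopologicalSpace H'] {J : ModelWithCorners ℝ E' H'}
    {M : Type*} [TopologicalSpace M] [ChartedSpace H' M]
    {F : Type*} [NormedAddCommGroup F] [NormedSpace ℝ F] {K : M → V →L[ℝ] F} {p : M}
    (h : ∀ v, MDifferentiableAt J 𝓘(ℝ, F) (fun q => K q v) p) :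
    MDifferentiableAt J 𝓘(ℝ, V →L[ℝ] F) K p := by
  classical
  let b := Module.finBasis ℝ V
  -- The map `L i` is `y ↦ bᵢ* ⊗ y`, so that `K = ∑ L i (K bᵢ)`.
  let L (i) : F →L[ℝ] V →L[ℝ] F :=
    ContinuousLinearMap.smulRightL ℝ V F (LinearMap.toContinuousLinearMap (b.coord i))
  have hterm : ∀ i, MDifferentiableAt J 𝓘(ℝ, V →L[ℝ] F) (fun q => L i (K q (b i))) p := by
    intro i
    have hL : MDifferentiableAt 𝓘(ℝ, F) 𝓘(ℝ, V →L[ℝ] F) (L i) (K p (b i)) :=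
      (L i).differentiableAt.mdifferentiableAt
    exact hL.comp p (h (b i))
  have hsum : ∀ s : Finset (Fin (Module.finrank ℝ V)),
      MDifferentiableAt J 𝓘(ℝ, V →L[ℝ] F) (∑ i ∈ s, fun q => L i (K q (b i))) p := by
    intro s
    induction s using Finset.induction_on with
    | empty => exact mdifferentiableAt_const
    | insert i s hi ih => rw [Finset.sum_insert hi]; exact (hterm i).add ih
  convert hsum Finset.univ using 1
  ext q v
  have hv := congrArg (K q) (b.sum_repr v)
  rw [map_sum] at hv
  simpa [L] using hv.symm

theorem differentiableAt_inverse {F : Type*} [NormedAddCommGroup F] [NormedSpace ℝ F]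
    (e : V ≃L[ℝ] F) :
    DifferentiableAt ℝ (ContinuousLinearMap.inverse : (V →L[ℝ] F) → F →L[ℝ] V) e := by
  have : CompleteSpace V := FiniteDimensional.complete ℝ V
  exact (contDiffAt_map_inverse (n := 1) e).differentiableAt (by simp)

end LinearAlgebra

/-! ### Tangential and normal projections. -/

section TangentialPart

open Filter Topology

variable {E' : Type*} [NormedAddCommGroup E'] [NormedSpace ℝ E']
  {H' : Type*} [TopologicalSpace H'] {J : ModelWithCorners ℝ E' H'}
  {M : Type*} [TopologicalSpace M] [ChartedSpace H' M]
  {E : Type*} [NormedAddCommGroup E] [NormedSpace ℝ E]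
  {H : Type*} [TopologicalSpace H] {I : ModelWithCorners ℝ E H}
  {N : Type*} [TopologicalSpace N] [ChartedSpace H N] [IsManifold I ∞ N]
  {g : MetricTensor I N} {ι : M → N} {p : M}

theorem IsSmoothImmersion.inner_self_pos (hι : IsSmoothImmersion J I ι) {u : TangentSpace J p}
    (hu : u ≠ 0) : 0 < g.inner (ι p) (mfderiv J I ι p u) (mfderiv J I ι p u) :=
  g.pos _ _ fun h => hu (hι.injective p (h.trans (map_zero _).symm))

theorem IsSmoothImmersion.eq_of_inner (hι : IsSmoothImmersion J I ι) {u v : TangentSpace J p}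
    (h : ∀ w, g.inner (ι p) (mfderiv J I ι p u) (mfderiv J I ι p w)
      = g.inner (ι p) (mfderiv J I ι p v) (mfderiv J I ι p w)) : u = v := by
  by_contra hne
  have h1 := hι.inner_self_pos (g := g) (sub_ne_zero.2 hne)
  have h2 := h (u - v)
  simp only [map_sub, sub_apply] at h1 h2
  linarith

theorem tanPart_zero (g : MetricTensor I N) (ι : M → N) (p : M) :
    tanPart J g ι p (0 : TangentSpace I (ι p)) = 0 := by
  simp [tanPart]

variable [FiniteDimensional ℝ E']

theorem IsSmoothImmersion.isInvertible_inducedMetric (hι : IsSmoothImmersion J I ι) :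
    (inducedMetric J g ι p).IsInvertible :=
  isInvertible_of_posDef (V := E') (K := inducedMetric J g ι p) fun _ hu => hι.inner_self_pos hu

theorem IsSmoothImmersion.inner_tanPart (hι : IsSmoothImmersion J I ι) (w : TangentSpace I (ι p))
    (u : TangentSpace J p) :
    g.inner (ι p) (mfderiv J I ι p (tanPart J g ι p w)) (mfderiv J I ι p u)
      = g.inner (ι p) w (mfderiv J I ι p u) := by
  have h := (hι.isInvertible_inducedMetric (g := g) (p := p)).self_comp_inverse
  have h1 := congrArg (fun L => L ((g.inner (ι p) w).comp (mfderiv J I ι p))) h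
  exact congrArg (fun L => L u) h1

theorem IsSmoothImmersion.inner_norPart (hι : IsSmoothImmersion J I ι) (w : TangentSpace I (ι p))
    (u : TangentSpace J p) :
    g.inner (ι p) (norPart J g ι p w) (mfderiv J I ι p u) = 0 := by
  rw [norPart, map_sub, sub_apply, hι.inner_tanPart, sub_self]

theorem IsSmoothImmersion.norPart_of_inner (hι : IsSmoothImmersion J I ι)
    {w : TangentSpace I (ι p)} (hw : ∀ u, g.inner (ι p) w (mfderiv J I ι p u) = 0) :
    norPart J g ι p w = w := by
  have h : tanPart J g ι p w = 0 := hι.eq_of_inner (g := g) fun u => by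
    rw [hι.inner_tanPart, hw, map_zero, map_zero, zero_apply]
  rw [norPart, h, map_zero, sub_zero]

/-- In a trivialization of `TM` the tangential part is `K⁻¹ l`, with `K` the Gram form of the
induced metric and `l` the pairing of `W` with the frame. Both are differentiable, and so is
inversion at the invertible `K p`. -/
theorem DiffAlong.tanPart [IsManifold J ∞ M] (hι : IsSmoothImmersion J I ι)
    {W : (q : M) → TangentSpace I (ι q)} (hW : DiffAlong J ι W p) :
    DiffFieldAt (fun q => tanPart J g ι q (W q)) p := by
  have : CompleteSpace E' := FiniteDimensional.complete ℝ E'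
  set t := trivializationAt E' (TangentSpace J : M → Type _) p with ht
  let K (q : M) : E' →L[ℝ] E' →L[ℝ] ℝ :=
    (ContinuousLinearMap.precomp ℝ (t.symmL ℝ q)).comp
      ((inducedMetric J g ι q).comp (t.symmL ℝ q))
  let l (q : M) : E' →L[ℝ] ℝ :=
    (((g.inner (ι q) (W q)).comp (mfderiv J I ι q)).comp (t.symmL ℝ q))
  have hp : p ∈ t.baseSet := mem_chart_source H' p
  have hσ : ∀ a : E', DiffAlong J ι (fun q => mfderiv J I ι q (t.symmL ℝ q a)) p := by
    intro a
    refine DiffFieldAt.mfderiv_along hι.smooth ?_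
    have h : MDifferentiableAt J 𝓘(ℝ, E')
        (fun x => (t (⟨x, t.symmL ℝ x a⟩ : TangentBundle J M)).2) p := by
      refine (mdifferentiableAt_const (c := a)).congr_of_eventuallyEq ?_
      filter_upwards [t.open_baseSet.mem_nhds hp] with x hx
      rw [t.symmL_apply (R := ℝ) hx, t.apply_mk_symm hx]
    exact (t.mdifferentiableAt_section_iff J _ hp).2 h
  have hK : MDifferentiableAt J 𝓘(ℝ, E' →L[ℝ] E' →L[ℝ] ℝ) K p :=
    mdifferentiableAt_clm_of_apply fun a => mdifferentiableAt_clm_of_apply fun c =>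
      (hσ a).inner g (hσ c)
  have hl : MDifferentiableAt J 𝓘(ℝ, E' →L[ℝ] ℝ) l p :=
    mdifferentiableAt_clm_of_apply fun a => hW.inner g (hσ a)
  have hKinv : ∀ q ∈ t.baseSet, (K q).IsInvertible := by
    intro q hq
    refine isInvertible_of_posDef fun a ha => ?_
    refine hι.inner_self_pos fun h0 => ha ?_
    have := t.continuousLinearMapAt_symmL (R := ℝ) hq a
    rw [show t.symmL ℝ q a = 0 from h0, map_zero] at this
    exact this.symm
  obtain ⟨e, he⟩ := hKinv p hp
  have hinv : MDifferentiableAt J 𝓘(ℝ, (E' →L[ℝ] ℝ) →L[ℝ] E')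
      (fun q => (K q).inverse) p := by
    have h1 := differentiableAt_inverse e
    rw [he] at h1
    exact h1.mdifferentiableAt.comp p hK
  have hx : MDifferentiableAt J 𝓘(ℝ, E') (fun q => (K q).inverse (l q)) p := hinv.clm_apply hl
  refine (t.mdifferentiableAt_section_iff J _ hp).2 (hx.congr_of_eventuallyEq ?_)
  filter_upwards [t.open_baseSet.mem_nhds hp] with q hq
  refine ((hKinv q hq).inverse_apply_eq.2 ?_).symm
  ext c
  have h1 : t.symmL ℝ q (t (⟨q, SlantGeometry.tanPart J g ι q (W q)⟩ : TangentBundle J M)).2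
      = SlantGeometry.tanPart J g ι q (W q) := by
    rw [t.symmL_apply (R := ℝ) hq]
    exact t.symm_apply_apply_mk hq _
  change g.inner (ι q) (W q) (mfderiv J I ι q (t.symmL ℝ q c))
    = g.inner (ι q) (mfderiv J I ι q (t.symmL ℝ q (t (⟨q, SlantGeometry.tanPart J g ι q (W q)⟩ :
      TangentBundle J M)).2)) (mfderiv J I ι q (t.symmL ℝ q c))
  rw [h1, hι.inner_tanPart]

theorem DiffAlong.norPart [IsManifold J ∞ M] (hι : IsSmoothImmersion J I ι)
    {W : (q : M) → TangentSpace I (ι q)} (hW : DiffAlong J ι W p) :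
    DiffAlong J ι (fun q => norPart J g ι q (W q)) p :=
  hW.sub (DiffFieldAt.mfderiv_along hι.smooth (hW.tanPart hι))

end TangentialPart

/-- A real vector space with an endomorphism squaring to a negative multiple of the identity has
even dimension. -/
theorem even_finrank_of_comp_self {V : Type*} [AddCommGroup V] [Module ℝ V]
    {f : V →ₗ[ℝ] V} {c : ℝ} (hc : 0 < c) (hf : ∀ v, f (f v) = -(c • v)) :
    Even (Module.finrank ℝ V) := by
  by_contra hodd
  rw [Nat.not_even_iff_odd] at hodd
  have h1 : f ∘ₗ f = (-c) • LinearMap.id := by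
    ext v
    simp [hf]
  -- The relation `(det f)² = (-c)ⁿ` is impossible for odd `n`, the right side being negative.
  have h2 := congrArg LinearMap.det h1
  rw [LinearMap.det_comp, LinearMap.det_smul, LinearMap.det_id, mul_one, hodd.neg_pow] at h2
  nlinarith [mul_self_nonneg (LinearMap.det f), pow_pos hc (Module.finrank ℝ V)]

/-! ### Weingarten formula and self-adjointness. -/

section ShapeOperator

open Filter Topology

variable {E' : Type*} [NormedAddCommGroup E'] [NormedSpace ℝ E']
  {H' : Type*} [TopologicalSpace H'] {J : ModelWithCorners ℝ E' H'}
  {M : Type*} [TopologicalSpace M] [ChartedSpace H' M] [IsManifold J ∞ M]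
  {E : Type*} [NormedAddCommGroup E] [NormedSpace ℝ E] [FiniteDimensional ℝ E]
  {H : Type*} [TopologicalSpace H] {I : ModelWithCorners ℝ E H}
  {N : Type*} [TopologicalSpace N] [ChartedSpace H N] [IsManifold I ∞ N]
  {g : MetricTensor I N} {cov : CovariantDerivative I E (TangentSpace I : N → Type _)}
  {ι : M → N} {p : M}

/-- The Weingarten formula. -/
theorem inner_covAlong_normal (hcov : IsLeviCivita g cov) (hι : ContMDiff J I ∞ ι)
    {Z : (q : M) → TangentSpace I (ι q)} (hZ : DiffAlong J ι Z p)
    (hn : ∀ q u, g.inner (ι q) (Z q) (mfderiv J I ι q u) = 0) {V : VField J M}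
    (hV : DiffFieldAt V p) (u : TangentSpace J p) :
    g.inner (ι p) (covAlong cov ι Z p u) (mfderiv J I ι p (V p))
      = -g.inner (ι p) (Z p) (covAlong cov ι (fun q => mfderiv J I ι q (V q)) p u) := by
  have h := mvfderiv_inner_along hcov hZ (DiffFieldAt.mfderiv_along hι hV) u
  have h0 : mvfderiv J (fun q => g.inner (ι q) (Z q) (mfderiv J I ι q (V q))) p = 0 := by
    simp only [hn]
    rw [mvfderiv_const]
  rw [h0, zero_apply] at h
  linarith

variable [FiniteDimensional ℝ E']

/-- Only the value `Z` at `p` appears on the right, so the normal extension in the definition of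
`shapeOperator` plays no role. -/
theorem inner_shapeOperator (hcov : IsLeviCivita g cov) (hι : IsSmoothImmersion J I ι)
    {Z : TangentSpace I (ι p)} (hZ : ∀ u, g.inner (ι p) Z (mfderiv J I ι p u) = 0)
    {V : VField J M} (hV : DiffFieldAt V p) (u : TangentSpace J p) :
    g.inner (ι p) (mfderiv J I ι p (shapeOperator g cov ι p Z u)) (mfderiv J I ι p (V p))
      = g.inner (ι p) Z (covAlong cov ι (fun q => mfderiv J I ι q (V q)) p u) := by
  have hd : DiffAlong J ι (fun q => norPart J g ι q (extend E Z (ι q))) p :=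
    DiffAlong.norPart hι (DiffAlong.comp (diffFieldAt_extend Z)
      (hι.smooth.mdifferentiableAt (by simp)))
  have h := inner_covAlong_normal hcov hι.smooth hd (fun q u => hι.inner_norPart _ u) hV u
  rw [extend_apply_self, hι.norPart_of_inner hZ] at h
  rw [shapeOperator, map_neg, map_neg, neg_apply, hι.inner_tanPart, h, neg_neg]

theorem inner_shapeOperator_comm [J.Boundaryless] (hcov : IsLeviCivita g cov)
    (hι : IsSmoothImmersion J I ι) {Z : TangentSpace I (ι p)}
    (hZ : ∀ u, g.inner (ι p) Z (mfderiv J I ι p u) = 0) (u v : TangentSpace J p) :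
    g.inner (ι p) (mfderiv J I ι p (shapeOperator g cov ι p Z u)) (mfderiv J I ι p v)
      = g.inner (ι p) (mfderiv J I ι p (shapeOperator g cov ι p Z v)) (mfderiv J I ι p u) := by
  have h1 := inner_shapeOperator hcov hι hZ (diffFieldAt_extend v) u
  have h2 := inner_shapeOperator hcov hι hZ (diffFieldAt_extend u) v
  rw [covAlong_mfderiv_extend_comm hcov hι.smooth, ← h2] at h1
  simpa only [extend_apply_self] using h1

theorem shapeOperator_zero_left (hcov : IsLeviCivita g cov) (hι : IsSmoothImmersion J I ι)
    (u : TangentSpace J p) : shapeOperator g cov ι p 0 u = 0 := by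
  refine hι.eq_of_inner (g := g) fun w => ?_
  have h := inner_shapeOperator hcov hι (Z := 0) (by simp) (diffFieldAt_extend w) u
  rw [extend_apply_self] at h
  rw [h]
  simp

end ShapeOperator

/-- Cauchy–Schwarz, from the nonnegativity of the squared length of `g(w,w) v - g(v,w) w`. -/
theorem MetricTensor.inner_mul_inner_le {E : Type*} [NormedAddCommGroup E] [NormedSpace ℝ E]
    {H : Type*} [TopologicalSpace H] {I : ModelWithCorners ℝ E H}
    {N : Type*} [TopologicalSpace N] [ChartedSpace H N] [IsManifold I ∞ N]
    (g : MetricTensor I N) {x : N} (v w : TangentSpace I x) :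
    g.inner x v w ^ 2 ≤ g.inner x v v * g.inner x w w := by
  have hnonneg : ∀ u : TangentSpace I x, 0 ≤ g.inner x u u := by
    intro u
    rcases eq_or_ne u 0 with rfl | hu
    · simp
    · exact (g.pos _ _ hu).le
  rcases eq_or_ne w 0 with rfl | hw
  · simp
  have hw0 := g.pos _ _ hw
  have h := hnonneg (g.inner x w w • v - g.inner x v w • w)
  simp only [map_sub, map_smul, sub_apply, smul_apply, smul_eq_mul, g.symm x w v] at h
  have h2 : 0 ≤ g.inner x w w * (g.inner x v v * g.inner x w w - g.inner x v w ^ 2) := by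
    linarith
  linarith [nonneg_of_mul_nonneg_right h2 hw0]

namespace AlmostContactMetric

/-! ### Slant submanifolds: the endomorphism `T` and the main computation. -/

section Slant

open Filter Topology

variable {E' : Type*} [NormedAddCommGroup E'] [NormedSpace ℝ E']
  {H' : Type*} [TopologicalSpace H'] {J : ModelWithCorners ℝ E' H'}
  {M : Type*} [TopologicalSpace M] [ChartedSpace H' M]
  {E : Type*} [NormedAddCommGroup E] [NormedSpace ℝ E]
  {H : Type*} [TopologicalSpace H] {I : ModelWithCorners ℝ E H}
  {N : Type*} [TopologicalSpace N] [ChartedSpace H N] [IsManifold I ∞ N]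
  {S : AlmostContactMetric I N} {ι : M → N} {p : M}

theorem φ_mfderiv (S : AlmostContactMetric I N) (X : TangentSpace J p) :
    S.φ (ι p) (mfderiv J I ι p X) = mfderiv J I ι p (S.tanφ J ι p X) + S.norφ J ι p X := by
  simp [norφ, norPart, tanφ]

theorem η_mfderiv {X : TangentSpace J p} (hX : X ∈ S.tangentOne J ι p) :
    S.η (ι p) (mfderiv J I ι p X) = 0 := by
  rw [S.η_eq_inner]; exact hX

variable (J) in
/-- `M_p` as a subspace of the tangent space. -/
def tangentOneₗ (S : AlmostContactMetric I N) (ι : M → N) (p : M) :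
    Submodule ℝ (TangentSpace J p) :=
  LinearMap.ker ((S.g.inner (ι p) (S.ξ (ι p))).comp (mfderiv J I ι p) :
    TangentSpace J p →ₗ[ℝ] ℝ)

theorem mem_tangentOneₗ {X : TangentSpace J p} :
    X ∈ S.tangentOneₗ J ι p ↔ X ∈ S.tangentOne J ι p := by
  change S.g.inner (ι p) (S.ξ (ι p)) (mfderiv J I ι p X) = 0 ↔
    S.g.inner (ι p) (mfderiv J I ι p X) (S.ξ (ι p)) = 0
  rw [S.g.symm]

variable (J) in
/-- `T` as a linear endomorphism of the tangent space. -/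
def tanφₗ (S : AlmostContactMetric I N) (ι : M → N) (p : M) :
    TangentSpace J p →ₗ[ℝ] TangentSpace J p where
  toFun := S.tanφ J ι p
  map_add' X Y := by
    simp [tanφ, tanPart, ContinuousLinearMap.add_comp]
  map_smul' c X := by
    simp [tanφ, tanPart, ContinuousLinearMap.smul_comp]

variable [FiniteDimensional ℝ E']

theorem inner_tanφ (hι : IsSmoothImmersion J I ι) (X Y : TangentSpace J p) :
    S.g.inner (ι p) (mfderiv J I ι p (S.tanφ J ι p X)) (mfderiv J I ι p Y)
      = S.g.inner (ι p) (S.φ (ι p) (mfderiv J I ι p X)) (mfderiv J I ι p Y) :=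
  hι.inner_tanPart _ _

theorem inner_norφ (hι : IsSmoothImmersion J I ι) (X Y : TangentSpace J p) :
    S.g.inner (ι p) (S.norφ J ι p X) (mfderiv J I ι p Y) = 0 :=
  hι.inner_norPart _ _

theorem inner_tanφ_left (hι : IsSmoothImmersion J I ι) (X Y : TangentSpace J p) :
    S.g.inner (ι p) (mfderiv J I ι p (S.tanφ J ι p X)) (mfderiv J I ι p Y)
      = -S.g.inner (ι p) (mfderiv J I ι p X) (mfderiv J I ι p (S.tanφ J ι p Y)) := by
  rw [inner_tanφ hι, S.inner_φ_left, S.g.symm _ (mfderiv J I ι p X), S.g.symm _ (mfderiv J I ι p X),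
    inner_tanφ hι]

/-- On a slant submanifold, `T` scales the length of the vectors of `M_p` by `cos θ`. -/
theorem IsPointwiseSlant.inner_tanφ_self {θ : M → ℝ} (hθ : S.IsPointwiseSlant J ι θ)
    (hι : IsSmoothImmersion J I ι) {X : TangentSpace J p} (hX : X ∈ S.tangentOne J ι p)
    (hTX : S.tanφ J ι p X ∈ S.tangentOne J ι p) :
    S.g.inner (ι p) (mfderiv J I ι p (S.tanφ J ι p X)) (mfderiv J I ι p (S.tanφ J ι p X))
      = Real.cos (θ p) ^ 2 * S.g.inner (ι p) (mfderiv J I ι p X) (mfderiv J I ι p X) := by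
  rcases eq_or_ne X 0 with rfl | hX0
  · rw [show S.tanφ J ι p 0 = 0 from (S.tanφₗ J ι p).map_zero]
    simp
  obtain ⟨⟨Y, hY, hY0, hα⟩, hmin⟩ := hθ p X hX hX0
  set a := S.g.inner (ι p) (mfderiv J I ι p X) (mfderiv J I ι p X) with ha
  have ha0 : 0 < a := hι.inner_self_pos hX0
  have hφ : S.g.inner (ι p) (S.φ (ι p) (mfderiv J I ι p X)) (S.φ (ι p) (mfderiv J I ι p X))
      = a := by
    rw [S.compatible, η_mfderiv hX, mul_zero, sub_zero]
  -- The numerator `g(φX, Y)` equals `g(TX, Y)`, and `|φX| = |X|`. Cauchy–Schwarz keeps the quotient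
  -- in `[-1, 1]`, so `cos` undoes `arccos`.
  have hcos : ∀ Y : TangentSpace J p, Y ≠ 0 →
      Real.cos (S.g.angle (S.φ (ι p) (mfderiv J I ι p X)) (mfderiv J I ι p Y)) ^ 2
        * (a * S.g.inner (ι p) (mfderiv J I ι p Y) (mfderiv J I ι p Y))
      = S.g.inner (ι p) (mfderiv J I ι p (S.tanφ J ι p X)) (mfderiv J I ι p Y) ^ 2 ∧
      Real.cos (S.g.angle (S.φ (ι p) (mfderiv J I ι p X)) (mfderiv J I ι p Y))
      = S.g.inner (ι p) (mfderiv J I ι p (S.tanφ J ι p X)) (mfderiv J I ι p Y)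
        / (Real.sqrt a * Real.sqrt (S.g.inner (ι p) (mfderiv J I ι p Y) (mfderiv J I ι p Y))) := by
    intro Y hY0
    have hb0 := hι.inner_self_pos (g := S.g) hY0
    have hcs := S.g.inner_mul_inner_le (S.φ (ι p) (mfderiv J I ι p X)) (mfderiv J I ι p Y)
    rw [hφ, ← inner_tanφ hι] at hcs
    rw [MetricTensor.angle, MetricTensor.length, MetricTensor.length, hφ, ← inner_tanφ hι]
    set b := S.g.inner (ι p) (mfderiv J I ι p Y) (mfderiv J I ι p Y)
    set t := S.g.inner (ι p) (mfderiv J I ι p (S.tanφ J ι p X)) (mfderiv J I ι p Y)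
    have hs : 0 < Real.sqrt a * Real.sqrt b := by positivity
    have hs2 : (Real.sqrt a * Real.sqrt b) ^ 2 = a * b := by
      rw [mul_pow, Real.sq_sqrt ha0.le, Real.sq_sqrt hb0.le]
    have habs := abs_le_of_sq_le_sq' (hcs.trans_eq hs2.symm) hs.le
    rw [Real.cos_arccos (by rw [le_div_iff₀ hs]; linarith) (by rw [div_le_iff₀ hs]; linarith)]
    refine ⟨?_, rfl⟩
    rw [← hs2, div_pow, div_mul_cancel₀ _ (by positivity)]
  have hrange : ∀ Y, S.g.angle (S.φ (ι p) (mfderiv J I ι p X)) (mfderiv J I ι p Y)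
      ∈ Set.Icc 0 Real.pi := fun Y => ⟨Real.arccos_nonneg _, Real.arccos_le_pi _⟩
  have h1 := (hcos Y hY0).1
  have hb0 := hι.inner_self_pos (g := S.g) hY0
  -- Lower bound: Cauchy–Schwarz for `TX` and the minimizing `Y` gives `cos² θ |X|² ≤ |TX|²`.
  have hcs := S.g.inner_mul_inner_le (mfderiv J I ι p (S.tanφ J ι p X)) (mfderiv J I ι p Y)
  rw [← h1, ← hα, ← mul_assoc] at hcs
  have hle := le_of_mul_le_mul_right hcs hb0
  refine le_antisymm ?_ hle
  rcases eq_or_ne (S.tanφ J ι p X) 0 with h0 | h0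
  · rw [h0]
    simpa using mul_nonneg (sq_nonneg _) ha0.le
  have ht0 := hι.inner_self_pos (g := S.g) h0
  obtain ⟨h2, h3⟩ := hcos _ h0
  have hpos : 0 ≤ Real.cos (S.g.angle (S.φ (ι p) (mfderiv J I ι p X))
      (mfderiv J I ι p (S.tanφ J ι p X))) := by
    rw [h3]; positivity
  -- Upper bound: `TX` itself lies in `M_p`, so its angle with `φX` is at least `θ`. Its cosine is
  -- nonnegative, hence the inequality of cosines may be squared.
  have hlow := Real.strictAntiOn_cos.antitoneOn (hα ▸ hrange Y) (hrange _)
    (hmin ⟨S.tanφ J ι p X, hTX, h0, rfl⟩)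
  have hsq := pow_le_pow_left₀ hpos hlow 2
  set t := S.g.inner (ι p) (mfderiv J I ι p (S.tanφ J ι p X)) (mfderiv J I ι p (S.tanφ J ι p X))
  rw [← mul_assoc, sq t] at h2
  rw [← mul_right_cancel₀ ht0.ne' h2]
  exact mul_le_mul_of_nonneg_right hsq ha0.le

/-- On a slant submanifold, `T² = -cos² θ` on `M_p`. -/
theorem IsPointwiseSlant.tanφ_tanφ {θ : M → ℝ} (hθ : S.IsPointwiseSlant J ι θ)
    (hι : IsSmoothImmersion J I ι)
    (hT : ∀ X ∈ S.tangentOne J ι p, S.tanφ J ι p X ∈ S.tangentOne J ι p)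
    {X : TangentSpace J p} (hX : X ∈ S.tangentOne J ι p) :
    S.tanφ J ι p (S.tanφ J ι p X) = -(Real.cos (θ p) ^ 2 • X) := by
  have hT' : ∀ X ∈ S.tangentOneₗ J ι p, S.tanφₗ J ι p X ∈ S.tangentOneₗ J ι p :=
    fun X hX => mem_tangentOneₗ.2 (hT X (mem_tangentOneₗ.1 hX))
  have hX' := mem_tangentOneₗ.2 hX
  have hself : ∀ Y ∈ S.tangentOneₗ J ι p,
      S.g.inner (ι p) (mfderiv J I ι p (S.tanφₗ J ι p Y)) (mfderiv J I ι p (S.tanφₗ J ι p Y))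
        = Real.cos (θ p) ^ 2 * S.g.inner (ι p) (mfderiv J I ι p Y) (mfderiv J I ι p Y) :=
    fun Y hY => hθ.inner_tanφ_self hι (mem_tangentOneₗ.1 hY) (hT Y (mem_tangentOneₗ.1 hY))
  -- Polarizing the length identity at `X + D` gives `g(TX, TD) = c g(X, D)` with `c = cos² θ`;
  -- skewness of `T` turns this into `g(D, D) = 0`.
  set D := S.tanφₗ J ι p (S.tanφₗ J ι p X) + Real.cos (θ p) ^ 2 • X with hD
  have hDm : D ∈ S.tangentOneₗ J ι p :=
    Submodule.add_mem _ (hT' _ (hT' _ hX')) (Submodule.smul_mem _ _ hX')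
  have h1 := hself _ (Submodule.add_mem _ hX' hDm)
  rw [map_add] at h1
  simp only [map_add, add_apply] at h1
  rw [hself X hX', hself D hDm, S.g.symm _ (mfderiv J I ι p D) (mfderiv J I ι p X),
    S.g.symm _ (mfderiv J I ι p (S.tanφₗ J ι p D)) (mfderiv J I ι p (S.tanφₗ J ι p X))] at h1
  have h2 : S.g.inner (ι p) (mfderiv J I ι p (S.tanφₗ J ι p (S.tanφₗ J ι p X)))
      (mfderiv J I ι p D) = -S.g.inner (ι p) (mfderiv J I ι p (S.tanφₗ J ι p X))
        (mfderiv J I ι p (S.tanφₗ J ι p D)) := inner_tanφ_left hι _ _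
  have h3 : S.g.inner (ι p) (mfderiv J I ι p D) (mfderiv J I ι p D) = 0 := by
    have hDv : ∀ v, S.g.inner (ι p) (mfderiv J I ι p D) v
        = S.g.inner (ι p) (mfderiv J I ι p (S.tanφₗ J ι p (S.tanφₗ J ι p X))) v
          + Real.cos (θ p) ^ 2 * S.g.inner (ι p) (mfderiv J I ι p X) v := by
      intro v
      simp only [hD, map_add, map_smul, add_apply, smul_apply, smul_eq_mul]
    rw [hDv, h2]
    linarith
  have h4 : D = 0 := by
    by_contra h
    exact (hι.inner_self_pos h).ne' h3
  exact eq_neg_of_add_eq_zero_left h4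

/-- On `M_p` the map `T / cos θ` is a complex structure. -/
theorem even_finrank_tangentOneₗ {θ : M → ℝ} (hθ : S.IsPointwiseSlant J ι θ)
    (hι : IsSmoothImmersion J I ι)
    (hT : ∀ X ∈ S.tangentOne J ι p, S.tanφ J ι p X ∈ S.tangentOne J ι p)
    (hc : Real.cos (θ p) ≠ 0) : Even (Module.finrank ℝ (S.tangentOneₗ J ι p)) := by
  have hT' : ∀ X ∈ S.tangentOneₗ J ι p, S.tanφₗ J ι p X ∈ S.tangentOneₗ J ι p :=
    fun X hX => mem_tangentOneₗ.2 (hT X (mem_tangentOneₗ.1 hX))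
  refine even_finrank_of_comp_self (f := (S.tanφₗ J ι p).restrict hT')
    (c := Real.cos (θ p) ^ 2) (by positivity) fun v => Subtype.ext ?_
  exact hθ.tanφ_tanφ hι hT (mem_tangentOneₗ.1 v.2)

/-- If `cos θ ≠ 0`, the tangential part of `ξ` vanishes everywhere or nowhere, because the spaces
`M_p` are even dimensional. -/
theorem tanPart_ξ_eq_zero {θ : ℝ} (hθ : S.IsSlant J ι θ) (hι : IsSmoothImmersion J I ι)
    (hT : ∀ p, ∀ X ∈ S.tangentOne J ι p, S.tanφ J ι p X ∈ S.tangentOne J ι p)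
    (hc : Real.cos θ ≠ 0) (hp : tanPart J S.g ι p (S.ξ (ι p)) = 0) (q : M) :
    tanPart J S.g ι q (S.ξ (ι q)) = 0 := by
  by_contra hq
  -- At `p` the space `M_p` is all of `T_pM`, so `dim M` is even; at `q` it would be a hyperplane,
  -- making `dim M - 1` even too.
  have h1 : S.tangentOneₗ J ι p = ⊤ := by
    refine eq_top_iff.2 fun X _ => ?_
    change S.g.inner (ι p) (S.ξ (ι p)) (mfderiv J I ι p X) = 0
    rw [← hι.inner_tanPart, hp, map_zero, map_zero, zero_apply]
  have h2 := even_finrank_tangentOneₗ hθ hι (hT p) hc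
  rw [h1, finrank_top] at h2
  have h3 := even_finrank_tangentOneₗ hθ hι (hT q) hc
  have : FiniteDimensional ℝ (TangentSpace J q) := inferInstanceAs (FiniteDimensional ℝ E')
  have h4 := Module.Dual.finrank_ker_add_one_of_ne_zero (K := ℝ) (V₁ := TangentSpace J q)
    (f := ((S.g.inner (ι q) (S.ξ (ι q))).comp (mfderiv J I ι q) :
      TangentSpace J q →ₗ[ℝ] ℝ)) fun h => hq <| hι.eq_of_inner (g := S.g) fun w => by
        rw [hι.inner_tanPart, map_zero, map_zero, zero_apply]
        exact LinearMap.congr_fun h w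
  change Module.finrank ℝ (S.tangentOneₗ J ι q) + 1 = Module.finrank ℝ E' at h4
  change Even (Module.finrank ℝ E') at h2
  rw [← h4, Nat.even_add_one] at h2
  exact h2 h3

variable [IsManifold J ∞ M]

/-- On a slant submanifold, vectors of `M_p` extend to local fields with values in `T¹M`. -/
theorem exists_diffFieldAt_tangentOne {θ : ℝ} (hθ : S.IsSlant J ι θ)
    (hι : IsSmoothImmersion J I ι)
    (hT : ∀ p, ∀ X ∈ S.tangentOne J ι p, S.tanφ J ι p X ∈ S.tangentOne J ι p)
    (hc : Real.cos θ ≠ 0) {X : TangentSpace J p} (hX : X ∈ S.tangentOne J ι p) :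
    ∃ V : VField J M, DiffFieldAt V p ∧ V p = X ∧ ∀ᶠ q in 𝓝 p, V q ∈ S.tangentOne J ι q := by
  -- If `ξ` is normal at `p`, parity makes it normal everywhere and any extension works.
  by_cases hp : tanPart J S.g ι p (S.ξ (ι p)) = 0
  · refine ⟨extend E' X, diffFieldAt_extend X, extend_apply_self .., .of_forall fun q => ?_⟩
    refine mem_tangentOneₗ.1 ?_
    change S.g.inner (ι q) (S.ξ (ι q)) (mfderiv J I ι q (extend E' X q)) = 0
    rw [← hι.inner_tanPart, tanPart_ξ_eq_zero hθ hι hT hc hp q, map_zero, map_zero, zero_apply]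
  have hξ : DiffAlong J ι (fun q => S.ξ (ι q)) p :=
    DiffAlong.comp (S.smoothFieldAt_ξ (ι p)).diffFieldAt (hι.smooth.mdifferentiableAt (by simp))
  let ζ : VField J M := fun q => tanPart J S.g ι q (S.ξ (ι q))
  have hζ : DiffFieldAt ζ p := hξ.tanPart hι
  let f (q : M) : ℝ := S.g.inner (ι q) (S.ξ (ι q)) (mfderiv J I ι q (ζ q))
  have hf : MDifferentiableAt J 𝓘(ℝ) f p := hξ.inner S.g (DiffFieldAt.mfderiv_along hι.smooth hζ)
  have hfp : f p ≠ 0 := by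
    have h := hι.inner_self_pos (g := S.g) hp
    rw [hι.inner_tanPart] at h
    exact h.ne'
  let k (q : M) : ℝ := S.g.inner (ι q) (S.ξ (ι q)) (mfderiv J I ι q (extend E' X q))
  have hk : MDifferentiableAt J 𝓘(ℝ) k p :=
    hξ.inner S.g (DiffFieldAt.mfderiv_along hι.smooth (diffFieldAt_extend X))
  have hkp : k p = 0 := by
    simp only [k, extend_apply_self]
    exact mem_tangentOneₗ.2 hX
  have hinv : MDifferentiableAt J 𝓘(ℝ) (fun q => (f q)⁻¹) p :=
    (differentiableAt_inv hfp).mdifferentiableAt.comp p hf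
  -- Orthogonal projection off `ζ`, the tangential part of `ξ`: `f = |ζ|²` stays nonzero near `p`,
  -- and `k p = 0` leaves the value at `p` unchanged.
  refine ⟨extend E' X - (fun q => k q * (f q)⁻¹) • ζ, ?_, ?_, ?_⟩
  · exact mdifferentiableAt_sub_section (diffFieldAt_extend X) ((hk.mul hinv).smul_section hζ)
  · simp only [Pi.sub_apply, Pi.smul_apply', hkp, extend_apply_self, zero_mul, zero_smul, sub_zero]
  · filter_upwards [hf.continuousAt.eventually_ne hfp] with q hq
    refine mem_tangentOneₗ.1 ?_
    change S.g.inner (ι q) (S.ξ (ι q)) (mfderiv J I ι q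
      ((extend E' X - (fun q => k q * (f q)⁻¹) • ζ) q)) = 0
    simp only [Pi.sub_apply, Pi.smul_apply', map_sub, map_smul]
    change k q - (k q * (f q)⁻¹) * f q = 0
    field_simp
    ring

variable [FiniteDimensional ℝ E] {cov : CovariantDerivative I E (TangentSpace I : N → Type _)}

theorem IsSlant.shapeOperator_norφ_tanφ [J.Boundaryless] {θ : ℝ} (hθ : S.IsSlant J ι θ)
    (hcov : IsLeviCivita S.g cov)
    (hφ : ∀ (x : N) (u v w : TangentSpace I x), S.η x v = 0 → S.η x w = 0 →
      S.g.inner x (S.covφ cov x u v) w = 0)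
    (hι : IsSmoothImmersion J I ι)
    (hT : ∀ p, ∀ X ∈ S.tangentOne J ι p, S.tanφ J ι p X ∈ S.tangentOne J ι p)
    {X : TangentSpace J p} (hX : X ∈ S.tangentOne J ι p) :
    shapeOperator S.g cov ι p (S.norφ J ι p X) (S.tanφ J ι p X)
      = shapeOperator S.g cov ι p (S.norφ J ι p (S.tanφ J ι p X)) X := by
  -- Here `TX = 0`, and both sides vanish by linearity; no extension inside `T¹M` is needed.
  by_cases hc : Real.cos θ = 0
  · have h0 : S.tanφ J ι p X = 0 := by
      by_contra h
      have h1 := IsPointwiseSlant.inner_tanφ_self hθ hι hX (hT p X hX)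
      rw [hc, zero_pow two_ne_zero, zero_mul] at h1
      exact (hι.inner_self_pos h).ne' h1
    have h2 : S.norφ J ι p 0 = 0 := by
      simp [norφ, norPart, tanPart_zero]
    rw [h0, h2, shapeOperator_zero_left hcov hι, shapeOperator, covAlong_zero_right, tanPart_zero,
      neg_zero]
  obtain ⟨V, hV, hVp, hVm⟩ := exists_diffFieldAt_tangentOne hθ hι hT hc hX
  set c := Real.cos θ ^ 2
  let W (q : M) : TangentSpace I (ι q) := mfderiv J I ι q (V q)
  have hW : DiffAlong J ι W p := DiffFieldAt.mfderiv_along hι.smooth hV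
  have hφW : DiffAlong J ι (fun q => S.φ (ι q) (W q)) p := hW.φ S
  let τ : VField J M := fun q => S.tanφ J ι q (V q)
  have hτ : DiffFieldAt τ p := hφW.tanPart hι
  have hdτ : DiffAlong J ι (fun q => mfderiv J I ι q (τ q)) p :=
    DiffFieldAt.mfderiv_along hι.smooth hτ
  have hν : DiffAlong J ι (fun q => S.norφ J ι q (V q)) p := hφW.norPart hι
  have hτp : τ p = S.tanφ J ι p X := congrArg (S.tanφ J ι p) hVp
  have hWp : W p = mfderiv J I ι p X := congrArg (mfderiv J I ι p) hVp
  refine hι.eq_of_inner (g := S.g) fun u => ?_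
  -- Self-adjointness makes `u` the direction of differentiation, leaving `TX` and `X` to be
  -- extended by `τ` and `V`.
  rw [inner_shapeOperator_comm hcov hι (inner_norφ hι X) _ u,
    inner_shapeOperator_comm hcov hι (inner_norφ hι (S.tanφ J ι p X)) X u]
  have h1 := inner_shapeOperator hcov hι (inner_norφ (S := S) hι X) hτ u
  have h2 := inner_covAlong_normal hcov hι.smooth hν (fun q w => inner_norφ hι (V q) w) hτ u
  have h3 := covAlong_sub (cov := cov) hφW hdτ u
  have h4 : ((fun q => S.φ (ι q) (W q)) - fun q => mfderiv J I ι q (τ q))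
      = fun q => S.norφ J ι q (V q) := rfl
  have h5 := inner_shapeOperator hcov hι (inner_norφ (S := S) hι (S.tanφ J ι p X)) hV u
  have h6 := mvfderiv_inner_along hcov hdτ hdτ u
  have h7 := mvfderiv_inner_along hcov hW hW u
  -- Constancy of `θ` is used: the factor `c` is not differentiated. With `h6` and `h7` this says
  -- `g(D_u TV, TX) = c g(D_u V, X)`.
  have h8 : mvfderiv J (fun q => S.g.inner (ι q) (mfderiv J I ι q (τ q))
        (mfderiv J I ι q (τ q))) p u
      = c * mvfderiv J (fun q => S.g.inner (ι q) (W q) (W q)) p u := by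
    have heq : (fun q => S.g.inner (ι q) (mfderiv J I ι q (τ q)) (mfderiv J I ι q (τ q)))
        =ᶠ[𝓝 p] (fun _ => c) * fun q => S.g.inner (ι q) (W q) (W q) := by
      filter_upwards [hVm] with q hq
      exact IsPointwiseSlant.inner_tanφ_self hθ hι hq (hT q _ hq)
    have h9 : mvfderiv J (fun q => S.g.inner (ι q) (mfderiv J I ι q (τ q))
        (mfderiv J I ι q (τ q))) p
      = mvfderiv J ((fun _ => c) * fun q => S.g.inner (ι q) (W q) (W q)) p := heq.mfderiv_eq
    rw [h9, mvfderiv_mul mdifferentiableAt_const (hW.inner S.g hW), mvfderiv_const]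
    simp
  have h10 := covAlong_φ (cov := cov) S hW u
  -- The only contribution of the ambient geometry: both `X` and `TX` are orthogonal to `ξ`.
  have h11 := hφ (ι p) (mfderiv J I ι p u) (W p) (mfderiv J I ι p (τ p))
    (by rw [hWp]; exact η_mfderiv hX) (by rw [hτp]; exact η_mfderiv (hT p X hX))
  have h12 := S.φ_mfderiv (J := J) (ι := ι) (S.tanφ J ι p X)
  rw [IsPointwiseSlant.tanφ_tanφ hθ hι (hT p) hX, map_neg, map_smul] at h12
  rw [h4] at h3
  simp only [hτp, hVp, hWp] at h1 h2 h3 h5 h6 h7 h10 h11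
  change _ = S.g.inner (ι p) _ (covAlong cov ι W p u) at h5
  rw [h3, h10, map_sub, sub_apply, map_add, add_apply, h11, S.inner_φ_left, h12] at h2
  simp only [map_add, map_neg, map_smul, smul_eq_mul] at h2
  rw [S.g.symm _ (mfderiv J I ι p (S.tanφ J ι p X))] at h6
  rw [S.g.symm _ (mfderiv J I ι p X)] at h7
  rw [S.g.symm _ (S.norφ J ι p (S.tanφ J ι p X))] at h5
  rw [h6, h7] at h8
  rw [h1, h5]
  -- The `-cX` part of `φTX` cancels against `g(D_u TV, TX)`, leaving `g(D_u V, FTX)`.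
  linarith

end Slant
end AlmostContactMetric

end SlantGeometry

end

theorem theorem4p11 {n m : ℕ}
    {N : Type*} [TopologicalSpace N] [ChartedSpace (EuclideanSpace ℝ (Fin (2 * n + 1))) N]
    [IsManifold (𝓡 (2 * n + 1)) ∞ N]
    {M : Type*} [TopologicalSpace M] [ChartedSpace (EuclideanSpace ℝ (Fin m)) M]
    [IsManifold (𝓡 m) ∞ M]
    (S : SlantGeometry.AlmostContactMetric (𝓡 (2 * n + 1)) N)
    (cov : CovariantDerivative (𝓡 (2 * n + 1)) (EuclideanSpace ℝ (Fin (2 * n + 1)))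
      (TangentSpace (𝓡 (2 * n + 1)) : N → Type _))
    (hcov : SlantGeometry.IsLeviCivita S.g cov)
    (hN : S.IsCosymplectic ∨ S.IsSasakian ∨ S.IsKenmotsu cov)
    (ι : M → N) (hι : SlantGeometry.IsSmoothImmersion (𝓡 m) (𝓡 (2 * n + 1)) ι)
    (θ : ℝ) (hθ : S.IsSlant (𝓡 m) ι θ)
    (hT : ∀ (p : M) (X : TangentSpace (𝓡 m) p), X ∈ S.tangentOne (𝓡 m) ι p →
      S.tanφ (𝓡 m) ι p X ∈ S.tangentOne (𝓡 m) ι p)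
    (p : M) (X : TangentSpace (𝓡 m) p) (hX : X ∈ S.tangentOne (𝓡 m) ι p) :
    SlantGeometry.shapeOperator S.g cov ι p (S.norφ (𝓡 m) ι p X) (S.tanφ (𝓡 m) ι p X)
      = SlantGeometry.shapeOperator S.g cov ι p
          (S.norφ (𝓡 m) ι p (S.tanφ (𝓡 m) ι p X)) X := by
  refine hθ.shapeOperator_norφ_tanφ hcov (fun x u v w hv hw => ?_) hι hT hX
  rcases hN with h | h | h
  · exact h.inner_covφ_eq_zero hcov x hv hw
  · exact h.inner_covφ_eq_zero hcov x hv hw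
  · exact h.inner_covφ_eq_zero x hv hw
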